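/- Throughout, for $x,y\in\mathbb R^n$ write $x\le y$ if $x_i\le y_i$ for all $i$, and $x\ll y$ (or $y\gg x$) if $x_i<y_i$ for all $i$. **Setting.** Let $U\subset\mathbb R^n$ be open and p-convex (if $x,y\in U$ and $x\le y$, then the segment from $x$ to $y$ lies in $U$), and let $f\in C^2(U\times\mathbb R,\mathbb R^n)$. A *parameter shift* from $\lambda_-$ to $\lambda_+$ (with $\lambda_-<\lambda_+$) is a function $\Lambda\in C^2(\mathbb R,(\lambda_-,\lambda_+))$ with $\lim_{s\to\pm\infty}\Lambda(s)=\lambda_\pm$ and $\lim_{s\to\pm\infty}\Lambda'(s)=0$. Fix such a $\Lambda$ and, for $r>0$, consider the nonautonomous system $\dot x=f(x,\Lambda(rt))$, $x\in U$ (equivalently $\dot x=f(x,\Lambda(s))$, $\dot s=r$). A *path* $(X(s),\Lambda(s))$ is a continuous curve $X:\mathbb R\to U$ with $f(X(s),\Lambda(s))=0$ for all $s$ and with limits $X_\pm=\lim_{s\to\pm\infty}X(s)\in U$. An equilibrium $x$ of $\dot x=f(x,\lambda)$ is *attracting* if all eigenvalues of $D_xf(x,\lambda)$ have negative real part. The path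 is *stable* if $X(s)$ is an attracting equilibrium of $\dot x=f(x,\Lambda(s))$ for every $s\in\mathbb R$. If $X_-$ is an attracting equilibrium for $\lambda_-$, the *pullback attractor* to $X_-$ at rate $r$ is the unique trajectory $x^r(t)$ of $\dot x=f(x,\Lambda(rt))$ in $U$, defined on some maximal interval $(-\infty,T)$ with $T\le\infty$, such that $x^r(t)\to X_-$ as $t\to-\infty$. There is *R-tipping away from $X_-$* for $\Lambda$ at rate $r$ if this pullback attractor exists and is unique and it is not the case that $T=\infty$ and $x^r(t)\to X_+$ as $t\to\infty$. **Proposition.** Suppose that for every $\lambda\in[\lambda_-,\lambda_+]$ the system $\dot x=f(x,\lambda)$ is monotone (cooperative), i.e. $\partial f_i/\partial x_j(x,\lambda)\ge 0$ for all $i\ne j$ and $x\in U$. Let $(p(s),\Lambda(s))$ be a path with limits $p_\pm$, and let $(q(s),\Lambda(s))$ be a stable path with limits $q_\pm$ such that $q_-$ is an attracting equilibrium for $\lambda=\lambda_-$. Suppose that each of the matrices $D_xf(p(s),\Lambda(s))$, $s\in\mathbb R$, and $D_xf(p_\pm,\lambda_\pm)$ has a positive eigenvalue with an eigenvector all of whose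 components are positive. Suppose finally that $q(s)\ll p(s)$ for all $s\in\mathbb R$ and $q_\pm\ll p_\pm$ (resp. $q(s)\gg p(s)$ for all $s\in\mathbb R$ and $q_\pm\gg p_\pm$). 1. If there are $u<v$ with $q(u)\gg p(v)$ (resp. $q(u)\ll p(v)$), then there is a $C^2$ function $\sigma:\mathbb R\to\mathbb R$ with $\sigma'>0$ and $\sigma(s)\to\pm\infty$ as $s\to\pm\infty$ such that $\tilde\Lambda=\Lambda\circ\sigma$ is again a parameter shift from $\lambda_-$ to $\lambda_+$ and there is R-tipping away from $q_-$ for $\tilde\Lambda$ at some rate $r>0$ (that is, the pullback attractor to $q_-$ of $\dot x=f(x,\tilde\Lambda(rt))$ does not converge to $q_+$). 2. If $q_-\gg p_+$ (resp. $q_-\ll p_+$), then there is $r_0>0$ such that for every $r>r_0$ there is R-tipping away from $q_-$ for $\Lambda$ at rate $r$. -/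

import Mathlib

open Set Filter Topology

noncomputable section

namespace RTip

/-- A parameter shift from `lm` to `lp`: a `C²` function with values in `(lm, lp)` that tends to
`lm`, `lp` at `-∞`, `+∞` and whose derivative tends to `0` at both ends. -/
structure IsParameterShift (lm lp : ℝ) (L : ℝ → ℝ) : Prop where
  contDiff : ContDiff ℝ 2 L
  mem_Ioo : ∀ s, L s ∈ Ioo lm lp
  tendsto_atBot : Tendsto L atBot (𝓝 lm)
  tendsto_atTop : Tendsto L atTop (𝓝 lp)
  deriv_atBot : Tendsto (deriv L) atBot (𝓝 0)
  deriv_atTop : Tendsto (deriv L) atTop (𝓝 0)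

/-- An admissible change of time: an increasing `C²` diffeomorphism of the real line. -/
structure IsReparametrization (σ : ℝ → ℝ) : Prop where
  contDiff : ContDiff ℝ 2 σ
  deriv_pos : ∀ s, 0 < deriv σ s
  tendsto_atBot : Tendsto σ atBot atBot
  tendsto_atTop : Tendsto σ atTop atTop

/-- The Jacobian matrix `(∂ gᵢ / ∂ xⱼ)` of a vector field `g` on `ℝⁿ` at `x`. -/
def jacobian {n : ℕ} (g : (Fin n → ℝ) → (Fin n → ℝ)) (x : Fin n → ℝ) :
    Matrix (Fin n) (Fin n) ℝ :=
  Matrix.of fun i j => fderiv ℝ g x (Pi.single j 1) i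

/-- `U` contains the segment between any two of its points that are ordered componentwise. -/
def PConvex {n : ℕ} (U : Set (Fin n → ℝ)) : Prop :=
  ∀ x ∈ U, ∀ y ∈ U, x ≤ y → segment ℝ x y ⊆ U

/-- The system `x' = g x` on `U` is monotone (cooperative): the off-diagonal partial derivatives
are nonnegative. -/
def IsMonotoneSystem {n : ℕ} (U : Set (Fin n → ℝ)) (g : (Fin n → ℝ) → (Fin n → ℝ)) : Prop :=
  ∀ x ∈ U, ∀ i j, i ≠ j → 0 ≤ jacobian g x i j

/-- `x` is an attracting equilibrium of `x' = g x`: all complex eigenvalues of the Jacobian matrix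
have negative real part. -/
def IsAttractingEquilibrium {n : ℕ} (g : (Fin n → ℝ) → (Fin n → ℝ)) (x : Fin n → ℝ) : Prop :=
  g x = 0 ∧ ∀ μ ∈ spectrum ℂ ((jacobian g x).map (algebraMap ℝ ℂ)), μ.re < 0

/-- The Jacobian matrix at `x` has a positive eigenvalue with an eigenvector all of whose
components are positive. -/
def HasPositiveUnstableDirection {n : ℕ} (g : (Fin n → ℝ) → (Fin n → ℝ)) (x : Fin n → ℝ) : Prop :=
  ∃ μ : ℝ, 0 < μ ∧ ∃ v : Fin n → ℝ, StrongLT 0 v ∧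
    Module.End.HasEigenvector (Matrix.toLin' (jacobian g x)) μ v

/-- `(X(s), L(s))` is a path: a continuous curve in `U` of equilibria `X(s)` of
`x' = f(x, L(s))` which has limits `Xm`, `Xp` in `U` at `-∞`, `+∞`. -/
structure IsPath {n : ℕ} (U : Set (Fin n → ℝ)) (f : (Fin n → ℝ) → ℝ → (Fin n → ℝ)) (L : ℝ → ℝ)
    (X : ℝ → (Fin n → ℝ)) (Xm Xp : Fin n → ℝ) : Prop where
  continuous : Continuous X
  mem : ∀ s, X s ∈ U
  equilibrium : ∀ s, f (X s) (L s) = 0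
  limit_mem_left : Xm ∈ U
  limit_mem_right : Xp ∈ U
  tendsto_atBot : Tendsto X atBot (𝓝 Xm)
  tendsto_atTop : Tendsto X atTop (𝓝 Xp)

/-- A stable path: a path of attracting equilibria. -/
structure IsStablePath {n : ℕ} (U : Set (Fin n → ℝ)) (f : (Fin n → ℝ) → ℝ → (Fin n → ℝ))
    (L : ℝ → ℝ) (X : ℝ → (Fin n → ℝ)) (Xm Xp : Fin n → ℝ) : Prop
    extends IsPath U f L X Xm Xp where
  attracting : ∀ s, IsAttractingEquilibrium (fun x => f x (L s)) (X s)

/-- On the open set of times `J`, the curve `x` is a trajectory in `U` of `x' = f(x, L(rt))`,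
and `x(t) → Xm` as `t → -∞`. It is used with `J = (-∞, T)` and `J = ℝ`. -/
structure IsPullbackTrajectory {n : ℕ} (U : Set (Fin n → ℝ)) (f : (Fin n → ℝ) → ℝ → (Fin n → ℝ))
    (L : ℝ → ℝ) (r : ℝ) (Xm : Fin n → ℝ) (J : Set ℝ) (x : ℝ → (Fin n → ℝ)) : Prop where
  mem : ∀ t ∈ J, x t ∈ U
  hasDerivAt : ∀ t ∈ J, HasDerivAt x (f (x t) (L (r * t))) t
  tendsto_atBot : Tendsto x atBot (𝓝 Xm)

/-- The pullback attractor to `Xm` is well defined: a trajectory emanating from `Xm` at time `-∞`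
exists on some half-line `(-∞, T)`, and any two such trajectories coincide where both are defined,
so that all of them are restrictions of one trajectory. -/
def HasPullbackAttractor {n : ℕ} (U : Set (Fin n → ℝ)) (f : (Fin n → ℝ) → ℝ → (Fin n → ℝ))
    (L : ℝ → ℝ) (r : ℝ) (Xm : Fin n → ℝ) : Prop :=
  (∃ (T : ℝ) (x : ℝ → (Fin n → ℝ)), IsPullbackTrajectory U f L r Xm (Iio T) x) ∧
  ∀ (T : ℝ) (x y : ℝ → (Fin n → ℝ)), IsPullbackTrajectory U f L r Xm (Iio T) x →
    IsPullbackTrajectory U f L r Xm (Iio T) y → EqOn x y (Iio T)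

/-- The pullback attractor to `Xm` exists for all times and converges to `Xp` as `t → +∞`. -/
def EndpointTracks {n : ℕ} (U : Set (Fin n → ℝ)) (f : (Fin n → ℝ) → ℝ → (Fin n → ℝ))
    (L : ℝ → ℝ) (r : ℝ) (Xm Xp : Fin n → ℝ) : Prop :=
  ∃ x : ℝ → (Fin n → ℝ), IsPullbackTrajectory U f L r Xm univ x ∧ Tendsto x atTop (𝓝 Xp)

/-- R-tipping away from `Xm` at rate `r`: the pullback attractor to `Xm` is well defined and does
not converge to `Xp` (because it stays away from `Xp` at some arbitrarily late times, or because it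
ceases to exist in `U` in finite time). -/
def RTipping {n : ℕ} (U : Set (Fin n → ℝ)) (f : (Fin n → ℝ) → ℝ → (Fin n → ℝ))
    (L : ℝ → ℝ) (r : ℝ) (Xm Xp : Fin n → ℝ) : Prop :=
  HasPullbackAttractor U f L r Xm ∧ ¬ EndpointTracks U f L r Xm Xp

end RTip

end

/-! Everything rests on comparison with strict lower solutions, curves whose components grow more
slowly than the vector field along them. In a cooperative system a trajectory that starts above such
a curve stays above it (`IsStrictLower.strongLT`). Take `q` below `p`. At an attracting equilibrium
of a cooperative field the Jacobian `A` is Hurwitz with nonnegative off-diagonal entries, so `A w ≪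
0` for some `w ≫ 0` (`exists_pos_mulVec_neg`). Hence the field is strictly positive slightly below
`q`, in the direction `-w`. The positive unstable eigenvector makes it strictly positive slightly
above `p`. Both displacements can be made uniform along a path, giving Lipschitz curves
(`IsPath.exists_lower_curve`), which are strict lower solutions when traversed slowly enough. If
`q(u) ≫ p(v)`, let time run slowly up to `u`, jump quickly to `v`, then run slowly again. The
pullback attractor stays above the curve under `q` until the jump, loses little during it, and lands
above the curve over `p`. It stays there, so any limit at `+∞` lies above `p₊ ≫ q₊`. If `q₋ ≫ p₊`, a
large rate produces the jump, and constants near `q₋` and `p₊` serve as the two lower solutions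
(`strongLT_of_three_phases` covers both cases). The pullback attractor is well defined because, in
the sup norm weighted by `w`, the equation near `q₋` reads `y' = -K y + G(t, y)` with `G` Lipschitz
of constant below `K`; such an equation has exactly one bounded solution near `-∞`. The reversed
order follows from the reflection `x ↦ -x`. -/

namespace RTip

/-! ### Hurwitz matrices with nonnegative off-diagonal entries. -/

section MetzlerMatrices

variable {n : ℕ}

lemma mulVec_apply_eq_add_sum_erase (A : Matrix (Fin n) (Fin n) ℝ) (v : Fin n → ℝ) (i : Fin n) :
    A.mulVec v i = A i i * v i + ∑ j ∈ Finset.univ.erase i, A i j * v j := by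
  rw [Matrix.mulVec_eq_sum, Finset.sum_apply,
    ← Finset.add_sum_erase _ _ (Finset.mem_univ i)]
  simp

lemma det_scalar_sub_ne_zero {A : Matrix (Fin n) (Fin n) ℝ}
    (hA : ∀ μ ∈ spectrum ℂ (A.map (algebraMap ℝ ℂ)), μ.re < 0) {t : ℝ} (ht : 0 ≤ t) :
    (t • (1 : Matrix (Fin n) (Fin n) ℝ) - A).det ≠ 0 := by
  intro h0
  have hmem : (t : ℂ) ∈ spectrum ℂ (A.map (algebraMap ℝ ℂ)) := by
    rw [spectrum.mem_iff, Matrix.isUnit_iff_isUnit_det, isUnit_iff_ne_zero, not_not]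
    have hmap : algebraMap ℂ (Matrix (Fin n) (Fin n) ℂ) t - A.map (algebraMap ℝ ℂ)
        = (algebraMap ℝ ℂ).mapMatrix (t • (1 : Matrix (Fin n) (Fin n) ℝ) - A) := by
      ext i j
      by_cases hij : i = j <;> simp [Matrix.algebraMap_matrix_apply, hij]
    rw [hmap, ← RingHom.map_det, h0, map_zero]
  have := hA _ hmem
  simp at this
  linarith

/-- A Hurwitz matrix with nonnegative off-diagonal entries maps some positive vector to a negative
one. -/
theorem exists_pos_mulVec_neg {A : Matrix (Fin n) (Fin n) ℝ} (hoff : ∀ i j, i ≠ j → 0 ≤ A i j)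
    (hA : ∀ μ ∈ spectrum ℂ (A.map (algebraMap ℝ ℂ)), μ.re < 0) :
    ∃ w : Fin n → ℝ, StrongLT 0 w ∧ StrongLT (A.mulVec w) 0 := by
  set B : ℝ → Matrix (Fin n) (Fin n) ℝ := fun t => t • 1 - A with hB
  have hdet : ∀ t, 0 ≤ t → (B t).det ≠ 0 := fun t ht => det_scalar_sub_ne_zero hA ht
  -- The vector sought is `V 0 = (-A)⁻¹ 1`. Its positivity is carried down from large `t` along the
  -- resolvent, which exists for all `t ≥ 0` because `A` has no nonnegative real eigenvalue.
  set V : ℝ → Fin n → ℝ := fun t => (B t)⁻¹.mulVec 1 with hV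
  have hBc : Continuous B := by fun_prop
  have hVc : ContinuousOn V (Ici 0) := by
    have : ∀ t, V t = (B t).det⁻¹ • ((B t).adjugate.mulVec 1) := fun t => by
      simp only [hV, Matrix.inv_def, Ring.inverse_eq_inv', Matrix.smul_mulVec]
    simp only [funext this]
    refine ContinuousOn.smul (ContinuousOn.inv₀ hBc.matrix_det.continuousOn hdet) ?_
    exact (hBc.matrix_adjugate.matrix_mulVec continuous_const).continuousOn
  have heq : ∀ t, 0 ≤ t → ∀ i, t * V t i - A.mulVec (V t) i = 1 := fun t ht i => by
    have h1 : (B t).mulVec (V t) = 1 := by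
      simp only [hV, Matrix.mulVec_mulVec, Matrix.mul_nonsing_inv _ (hdet t ht).isUnit,
        Matrix.one_mulVec]
    have := congrFun h1 i
    simpa [hB, Matrix.sub_mulVec, Matrix.smul_mulVec] using this
  have hpos : ∀ t, 0 ≤ t → (∀ i, 0 ≤ V t i) → ∀ i, 0 < V t i := fun t ht hnn i => by
    refine lt_of_le_of_ne (hnn i) fun h0 => ?_
    have h := heq t ht i
    rw [mulVec_apply_eq_add_sum_erase, ← h0] at h
    have : 0 ≤ ∑ j ∈ Finset.univ.erase i, A i j * V t j :=
      Finset.sum_nonneg fun j hj => mul_nonneg (hoff i j (Finset.ne_of_mem_erase hj).symm) (hnn j)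
    linarith
  -- `R` dominates every row sum. At an index where `V R` is minimal and negative, the equation `(R
  -- - A) V = 1` would then have a nonpositive left side.
  set R : ℝ := ∑ i, |∑ j, A i j| with hR
  have hR0 : 0 ≤ R := Finset.sum_nonneg fun _ _ => abs_nonneg _
  have hlarge : ∀ i, 0 ≤ V R i := by
    by_contra! hneg
    obtain ⟨k, hk⟩ := hneg
    obtain ⟨i, -, hi⟩ := Finset.exists_min_image Finset.univ (V R) ⟨k, Finset.mem_univ k⟩
    have hVi : V R i < 0 := (hi k (Finset.mem_univ k)).trans_lt hk
    have h := heq R hR0 i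
    have h2 : (∑ j, A i j) * V R i ≤ A.mulVec (V R) i := by
      rw [mulVec_apply_eq_add_sum_erase, ← Finset.add_sum_erase _ _ (Finset.mem_univ i), add_mul,
        Finset.sum_mul]
      gcongr with j hj
      · exact hoff i j (Finset.ne_of_mem_erase hj).symm
      · exact hi j (Finset.mem_univ j)
    have h3 : ∑ j, A i j ≤ R := (le_abs_self _).trans
      (Finset.single_le_sum (f := fun i => |∑ j, A i j|) (fun _ _ => abs_nonneg _)
        (Finset.mem_univ i))
    nlinarith
  -- By `hpos`, nonnegative implies positive. So "all components positive" and "some component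
  -- negative" are disjoint relatively open conditions covering the connected interval, and the
  -- first holds at `R`.
  have hall : Icc 0 R ⊆ {t | ∀ i, 0 ≤ V t i} := by
    by_contra hcon
    obtain ⟨t, ht, hneg⟩ := not_subset.1 hcon
    simp only [mem_ofPred_eq, not_forall, not_le] at hneg
    have hc := hVc.mono (Icc_subset_Ici_self : Icc 0 R ⊆ Ici 0)
    have hc' : ∀ i, ContinuousOn (fun t => V t i) (Icc 0 R) := fun i =>
      (continuous_apply i).comp_continuousOn hc
    have h := isPreconnected_Icc (a := (0 : ℝ)) (b := R)
    rw [isPreconnected_iff_subset_of_disjoint] at h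
    have ho1 : ∃ u, IsOpen u ∧ {t | ∀ i, 0 < V t i} ∩ Icc 0 R = u ∩ Icc 0 R := by
      choose u hu hu' using fun i => (continuousOn_iff'.1 (hc' i)) (Ioi 0) isOpen_Ioi
      refine ⟨⋂ i, u i, isOpen_iInter_of_finite hu, ?_⟩
      ext s
      simp only [mem_inter_iff, mem_ofPred_eq, mem_iInter]
      refine and_congr_left fun hs => forall_congr' fun i => ?_
      have := Set.ext_iff.1 (hu' i) s
      simpa [hs] using this
    have ho2 : ∃ u, IsOpen u ∧ {t | ∃ i, V t i < 0} ∩ Icc 0 R = u ∩ Icc 0 R := by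
      choose u hu hu' using fun i => (continuousOn_iff'.1 (hc' i)) (Iio 0) isOpen_Iio
      refine ⟨⋃ i, u i, isOpen_iUnion hu, ?_⟩
      ext s
      simp only [mem_inter_iff, mem_ofPred_eq, mem_iUnion]
      refine and_congr_left fun hs => exists_congr fun i => ?_
      have := Set.ext_iff.1 (hu' i) s
      simpa [hs] using this
    obtain ⟨u₁, hu₁, e₁⟩ := ho1
    obtain ⟨u₂, hu₂, e₂⟩ := ho2
    have hm₁ : ∀ s ∈ Icc 0 R, (s ∈ u₁ ↔ ∀ i, 0 < V s i) := fun s hs => by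
      have := Set.ext_iff.1 e₁ s
      simpa [hs.1, hs.2] using this.symm
    have hm₂ : ∀ s ∈ Icc 0 R, (s ∈ u₂ ↔ ∃ i, V s i < 0) := fun s hs => by
      have := Set.ext_iff.1 e₂ s
      simpa [hs.1, hs.2] using this.symm
    have hcover : Icc 0 R ⊆ u₁ ∪ u₂ := fun s hs => by
      by_cases hs' : ∃ i, V s i < 0
      · exact Or.inr ((hm₂ s hs).2 hs')
      · exact Or.inl ((hm₁ s hs).2 (hpos s hs.1 (by push Not at hs'; exact hs')))
    have hdisj : Icc 0 R ∩ (u₁ ∩ u₂) = ∅ := by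
      ext s
      simp only [mem_inter_iff, mem_empty_iff_false, iff_false]
      rintro ⟨hs, h1, h2⟩
      obtain ⟨i, hi⟩ := (hm₂ s hs).1 h2
      exact absurd ((hm₁ s hs).1 h1 i) (not_lt.2 hi.le)
    rcases h u₁ u₂ hu₁ hu₂ hcover hdisj with h | h
    · obtain ⟨i, hi⟩ := hneg
      exact absurd ((hm₁ t ht).1 (h ht) i) (not_lt.2 hi.le)
    · obtain ⟨i, hi⟩ := (hm₂ R ⟨hR0, le_rfl⟩).1 (h ⟨hR0, le_rfl⟩)
      exact absurd (hlarge i) (not_le.2 hi)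
  refine ⟨V 0, hpos 0 le_rfl (hall ⟨le_rfl, hR0⟩), fun i => ?_⟩
  have := heq 0 le_rfl i
  simp only [Pi.zero_apply]
  linarith

end MetzlerMatrices

/-! ### Jacobians, the mean value theorem and the Kamke condition. -/

section Jacobian

variable {n : ℕ} {U : Set (Fin n → ℝ)} {f : (Fin n → ℝ) → ℝ → (Fin n → ℝ)}

lemma contDiffAt_uncurry (hU : IsOpen U)
    (hf : ContDiffOn ℝ 2 (fun z : (Fin n → ℝ) × ℝ => f z.1 z.2) (U ×ˢ univ))
    {x : Fin n → ℝ} (hx : x ∈ U) (l : ℝ) :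
    ContDiffAt ℝ 2 (fun z : (Fin n → ℝ) × ℝ => f z.1 z.2) (x, l) :=
  hf.contDiffAt ((hU.prod isOpen_univ).mem_nhds ⟨hx, mem_univ _⟩)

lemma hasFDerivAt_section (hU : IsOpen U)
    (hf : ContDiffOn ℝ 2 (fun z : (Fin n → ℝ) × ℝ => f z.1 z.2) (U ×ˢ univ))
    {x : Fin n → ℝ} (hx : x ∈ U) (l : ℝ) :
    HasFDerivAt (fun x => f x l) ((fderiv ℝ (fun z : (Fin n → ℝ) × ℝ => f z.1 z.2) (x, l)).comp
      (ContinuousLinearMap.inl ℝ (Fin n → ℝ) ℝ)) x := by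
  have h := ((contDiffAt_uncurry hU hf hx l).differentiableAt (by norm_num)).hasFDerivAt
  have h2 : HasFDerivAt (fun e : Fin n → ℝ => (e, l))
      (ContinuousLinearMap.inl ℝ (Fin n → ℝ) ℝ) x := hasFDerivAt_prodMk_left x l
  exact HasFDerivAt.comp x h h2

lemma jacobian_mulVec (g : (Fin n → ℝ) → (Fin n → ℝ)) (x v : Fin n → ℝ) :
    (jacobian g x).mulVec v = fderiv ℝ g x v := by
  ext i
  conv_rhs => rw [pi_eq_sum_univ' v]
  rw [Matrix.mulVec_eq_sum]
  simp [jacobian, map_sum]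

lemma continuousOn_jacobian (hU : IsOpen U)
    (hf : ContDiffOn ℝ 2 (fun z : (Fin n → ℝ) × ℝ => f z.1 z.2) (U ×ˢ univ)) :
    ContinuousOn (fun z : (Fin n → ℝ) × ℝ => jacobian (fun x => f x z.2) z.1) (U ×ˢ univ) := by
  have h := hf.continuousOn_fderiv_of_isOpen (hU.prod isOpen_univ) (by norm_num)
  refine continuousOn_pi.2 fun i => continuousOn_pi.2 fun j => ?_
  have h2 : ContinuousOn (fun z : (Fin n → ℝ) × ℝ =>
      fderiv ℝ (fun z : (Fin n → ℝ) × ℝ => f z.1 z.2) z (Pi.single j 1, 0) i) (U ×ˢ univ) :=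
    (continuous_apply i).comp_continuousOn (h.clm_apply continuousOn_const)
  refine h2.congr fun z hz => ?_
  simp [jacobian, (hasFDerivAt_section hU hf hz.1 z.2).fderiv]

lemma continuousAt_jacobian (hU : IsOpen U)
    (hf : ContDiffOn ℝ 2 (fun z : (Fin n → ℝ) × ℝ => f z.1 z.2) (U ×ˢ univ))
    {x : Fin n → ℝ} (hx : x ∈ U) (l : ℝ) :
    ContinuousAt (fun z : (Fin n → ℝ) × ℝ => jacobian (fun x => f x z.2) z.1) (x, l) :=
  (continuousOn_jacobian hU hf).continuousAt
    ((hU.prod isOpen_univ).mem_nhds ⟨hx, mem_univ _⟩)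

lemma continuousAt_uncurry (hU : IsOpen U)
    (hf : ContDiffOn ℝ 2 (fun z : (Fin n → ℝ) × ℝ => f z.1 z.2) (U ×ˢ univ))
    {x : Fin n → ℝ} (hx : x ∈ U) (l : ℝ) :
    ContinuousAt (fun z : (Fin n → ℝ) × ℝ => f z.1 z.2) (x, l) :=
  (contDiffAt_uncurry hU hf hx l).continuousAt

/-- Mean value theorem for one component of the vector field. -/
lemma exists_sub_eq_jacobian_mulVec (hU : IsOpen U)
    (hf : ContDiffOn ℝ 2 (fun z : (Fin n → ℝ) × ℝ => f z.1 z.2) (U ×ˢ univ))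
    {x y : Fin n → ℝ} (hxy : segment ℝ x y ⊆ U) (l : ℝ) (i : Fin n) :
    ∃ z ∈ segment ℝ x y,
      f y l i - f x l i = (jacobian (fun x => f x l) z).mulVec (y - x) i := by
  have hd : ∀ z ∈ segment ℝ x y, HasFDerivWithinAt (fun x => f x l i)
      ((ContinuousLinearMap.proj i).comp (fderiv ℝ (fun x => f x l) z)) (segment ℝ x y) z :=
    fun z hz => (hasFDerivAt_pi'.1
      (hasFDerivAt_section hU hf (hxy hz) l).differentiableAt.hasFDerivAt i).hasFDerivWithinAt
  obtain ⟨z, hz, h⟩ := domain_mvt hd (convex_segment x y) (left_mem_segment ℝ x y)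
    (right_mem_segment ℝ x y)
  exact ⟨z, hz, by rw [h, jacobian_mulVec]; rfl⟩

/-- The Kamke property of a cooperative vector field. -/
lemma apply_le_apply_of_le_of_eq (hU : IsOpen U) (hUc : PConvex U)
    (hf : ContDiffOn ℝ 2 (fun z : (Fin n → ℝ) × ℝ => f z.1 z.2) (U ×ˢ univ)) {l : ℝ}
    (hmono : IsMonotoneSystem U (fun x => f x l)) {x y : Fin n → ℝ} (hx : x ∈ U) (hy : y ∈ U)
    (hxy : x ≤ y) {i : Fin n} (hi : x i = y i) : f x l i ≤ f y l i := by
  have hs := hUc x hx y hy hxy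
  obtain ⟨z, hz, h⟩ := exists_sub_eq_jacobian_mulVec hU hf hs l i
  rw [mulVec_apply_eq_add_sum_erase] at h
  have h2 : 0 ≤ ∑ j ∈ Finset.univ.erase i, jacobian (fun x => f x l) z i j * (y - x) j :=
    Finset.sum_nonneg fun j hj => mul_nonneg
      (hmono z (hs hz) i j (Finset.ne_of_mem_erase hj).symm) (sub_nonneg.2 (hxy j))
  have h3 : (y - x) i = 0 := by simp [hi]
  rw [h3] at h
  linarith

end Jacobian

/-! ### Strict lower solutions and comparison. -/

section Comparison

variable {n : ℕ}

/-- On the set of times `J`, the curve `y` is a strict lower solution of `x' = f(x, l(t))`: its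
components grow at most at a rate `κ` that is smaller than every component of the vector field
along `y`. -/
structure IsStrictLower (U : Set (Fin n → ℝ)) (f : (Fin n → ℝ) → ℝ → (Fin n → ℝ)) (l : ℝ → ℝ)
    (J : Set ℝ) (κ : ℝ) (y : ℝ → (Fin n → ℝ)) : Prop where
  continuousOn : ContinuousOn y J
  mem : ∀ t ∈ J, y t ∈ U
  growth : ∀ s ∈ J, ∀ t ∈ J, s ≤ t → ∀ i, y t i - y s i ≤ κ * (t - s)
  lt_field : ∀ t ∈ J, ∀ i, κ < f (y t) (l t) i

variable {U : Set (Fin n → ℝ)} {f : (Fin n → ℝ) → ℝ → (Fin n → ℝ)} {l : ℝ → ℝ} {κ : ℝ}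
  {x y : ℝ → (Fin n → ℝ)}

lemma IsStrictLower.mono {J J' : Set ℝ} (h : IsStrictLower U f l J κ y) (hJ : J' ⊆ J) :
    IsStrictLower U f l J' κ y :=
  ⟨h.continuousOn.mono hJ, fun t ht => h.mem t (hJ ht),
    fun s hs t ht => h.growth s (hJ hs) t (hJ ht), fun t ht => h.lt_field t (hJ ht)⟩

/-- Comparison principle for cooperative systems. -/
theorem IsStrictLower.strongLT (hU : IsOpen U) (hUc : PConvex U)
    (hf : ContDiffOn ℝ 2 (fun z : (Fin n → ℝ) × ℝ => f z.1 z.2) (U ×ˢ univ))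
    {t₀ t₁ : ℝ} (hmono : ∀ t ∈ Icc t₀ t₁, IsMonotoneSystem U (fun x => f x (l t)))
    (hy : IsStrictLower U f l (Icc t₀ t₁) κ y) (hxU : ∀ t ∈ Icc t₀ t₁, x t ∈ U)
    (hx : ∀ t ∈ Icc t₀ t₁, HasDerivAt x (f (x t) (l t)) t) (h0 : StrongLT (y t₀) (x t₀)) :
    ∀ t ∈ Icc t₀ t₁, StrongLT (y t) (x t) := by
  by_contra! hcon
  obtain ⟨t, ht, hlt⟩ := hcon
  have hxc : ContinuousOn x (Icc t₀ t₁) := fun t ht => (hx t ht).continuousAt.continuousWithinAt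
  -- The least element of this compact set is the first time of contact, in some component `i`.
  -- There `y ≤ x` with equality at `i`, so the Kamke property applies.
  set S : Set ℝ := ⋃ i, {t ∈ Icc t₀ t₁ | x t i ≤ y t i} with hS
  have hSc : IsCompact S := by
    refine isCompact_iUnion fun i => isCompact_Icc.of_isClosed_subset ?_ (sep_subset _ _)
    exact isClosed_Icc.isClosed_le ((continuous_apply i).comp_continuousOn hxc)
      ((continuous_apply i).comp_continuousOn hy.continuousOn)
  have hSne : S.Nonempty := by
    simp only [StrongLT, not_forall, not_lt] at hlt
    obtain ⟨i, hi⟩ := hlt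
    exact ⟨t, mem_iUnion.2 ⟨i, ht, hi⟩⟩
  obtain ⟨τ, hτS, hτmin⟩ := hSc.exists_isLeast hSne
  obtain ⟨i, hτ, hi⟩ := mem_iUnion.1 hτS
  have hbefore : ∀ s ∈ Ico t₀ τ, ∀ j, y s j < x s j := fun s hs j => by
    by_contra! hj
    exact absurd (hτmin (mem_iUnion.2 ⟨j, ⟨hs.1, hs.2.le.trans hτ.2⟩, hj⟩)) (not_le.2 hs.2)
  have hτ0 : t₀ < τ := lt_of_le_of_ne hτ.1 fun h => by
    rw [← h] at hi; exact absurd (h0 i) (not_lt.2 hi)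
  have hne : (𝓝[Ico t₀ τ] τ).NeBot := by
    rw [← mem_closure_iff_nhdsWithin_neBot, closure_Ico hτ0.ne]; exact ⟨hτ0.le, le_rfl⟩
  have hsub : Ico t₀ τ ⊆ Icc t₀ t₁ := fun s hs => ⟨hs.1, hs.2.le.trans hτ.2⟩
  have hle : y τ ≤ x τ := fun j => by
    refine le_of_tendsto_of_tendsto
      (((continuous_apply j).comp_continuousOn hy.continuousOn τ hτ).mono_left
        (nhdsWithin_mono _ hsub))
      (((continuous_apply j).comp_continuousOn hxc τ hτ).mono_left (nhdsWithin_mono _ hsub)) ?_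
    filter_upwards [self_mem_nhdsWithin] with s hs using (hbefore s hs j).le
  have heq : y τ i = x τ i := le_antisymm (hle i) hi
  have hK := apply_le_apply_of_le_of_eq hU hUc hf (hmono τ hτ) (hy.mem τ hτ) (hxU τ hτ) hle heq
  have hder : HasDerivAt (fun t => x t i) (f (x τ) (l τ) i) τ := hasDerivAt_pi.1 (hx τ hτ) i
  have hslope := (hasDerivAt_iff_tendsto_slope.1 hder).mono_left
    (nhdsWithin_mono τ (fun s (hs : s ∈ Ico t₀ τ) => (ne_of_lt hs.2 : s ≠ τ)))
  -- Before contact `x i` exceeds `y i`, and at contact they agree. So backward difference quotients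
  -- of `x i` are at most those of `y i`, hence at most `κ`. This contradicts `κ < f (y τ) (l τ) i ≤
  -- f (x τ) (l τ) i`.
  have hκ : f (x τ) (l τ) i ≤ κ := by
    refine le_of_tendsto hslope ?_
    filter_upwards [self_mem_nhdsWithin] with s hs
    rw [slope_def_field, div_le_iff_of_neg (by linarith [hs.2])]
    have h1 := hy.growth s (hsub hs) τ hτ hs.2.le i
    have h2 := hbefore s hs i
    nlinarith
  linarith [hy.lt_field τ hτ i]

end Comparison

/-! ### Bounded solutions of damped equations on half-lines and on the line. -/

section LinearlyDamped

variable {E : Type*} [NormedAddCommGroup E] [NormedSpace ℝ E]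

/-- Multiplying by `exp (K (τ - t))` removes the damping term. The contribution of the starting time
`s` decays as `s → -∞` because `D` is bounded, so only the forcing remains. -/
lemma norm_le_div_of_hasDerivAt_damped {K R M T : ℝ} (hK : 0 < K) {D g : ℝ → E}
    (hD : ∀ t < T, HasDerivAt D (-(K • D t) + g t) t) (hg : ∀ t < T, ‖g t‖ ≤ R)
    (hM : ∀ t < T, ‖D t‖ ≤ M) {t : ℝ} (ht : t < T) : ‖D t‖ ≤ R / K := by
  have hR : 0 ≤ R := (norm_nonneg _).trans (hg t ht)
  have key : ∀ s < t, ‖D t‖ ≤ Real.exp (K * (s - t)) * M + R / K := fun s hs => by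
    have hexp : ∀ τ, HasDerivAt (fun τ => Real.exp (K * (τ - t))) (Real.exp (K * (τ - t)) * K) τ :=
      fun τ => by
        simpa using (((hasDerivAt_id τ).sub_const t).const_mul K).exp
    have hφ : ∀ τ < T, HasDerivAt (fun τ => Real.exp (K * (τ - t)) • D τ)
        (Real.exp (K * (τ - t)) • g τ) τ := fun τ hτ => by
      exact ((hexp τ).smul (hD τ hτ)).congr_deriv (by module)
    have hB : ∀ τ, HasDerivAt (fun τ => Real.exp (K * (s - t)) * M
        + R / K * (Real.exp (K * (τ - t)) - Real.exp (K * (s - t))))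
        (R / K * (Real.exp (K * (τ - t)) * K)) τ := fun τ =>
      (((hexp τ).sub_const _).const_mul _).const_add _
    have h := image_norm_le_of_norm_deriv_right_le_deriv_boundary (a := s) (b := t)
      (f := fun τ => Real.exp (K * (τ - t)) • D τ)
      (fun τ hτ => (hφ τ (hτ.2.trans_lt ht)).continuousAt.continuousWithinAt)
      (fun τ hτ => (hφ τ (hτ.2.trans ht)).hasDerivWithinAt) (by
        rw [norm_smul, Real.norm_of_nonneg (Real.exp_pos _).le, sub_self, mul_zero, add_zero]
        exact mul_le_mul_of_nonneg_left (hM s (hs.trans ht)) (Real.exp_pos _).le) hB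
      (fun τ hτ => by
        rw [norm_smul, Real.norm_of_nonneg (Real.exp_pos _).le]
        have := mul_le_mul_of_nonneg_left (hg τ (hτ.2.trans ht)) (Real.exp_pos (K * (τ - t))).le
        have h2 : R / K * (Real.exp (K * (τ - t)) * K) = Real.exp (K * (τ - t)) * R := by
          field_simp
        rwa [h2]) (right_mem_Icc.2 hs.le)
    simp only [sub_self, mul_zero, Real.exp_zero, one_smul] at h
    have h2 : 0 ≤ R / K * Real.exp (K * (s - t)) := by positivity
    linarith
  have hlim : Tendsto (fun s => Real.exp (K * (s - t)) * M + R / K) atBot (𝓝 (0 * M + R / K)) := by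
    refine ((Real.tendsto_exp_atBot.comp ?_).mul_const M).add_const _
    exact (tendsto_atBot_add_const_right _ (-t) tendsto_id).const_mul_atBot hK
  rw [zero_mul, zero_add] at hlim
  exact ge_of_tendsto hlim ((eventually_lt_atBot t).mono key)

/-- A bounded solution of `D' = -K D + g` on `(-∞, T)` with `‖g‖ ≤ H + k ‖D‖` and `k < K` is at
most `H / (K - k)` in norm. -/
lemma norm_le_of_hasDerivAt_damped {K k H M T : ℝ} (hk : 0 ≤ k) (hkK : k < K) {D g : ℝ → E}
    (hD : ∀ t < T, HasDerivAt D (-(K • D t) + g t) t) (hg : ∀ t < T, ‖g t‖ ≤ H + k * ‖D t‖)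
    (hM : ∀ t < T, ‖D t‖ ≤ M) {t : ℝ} (ht : t < T) : ‖D t‖ ≤ H / (K - k) := by
  set N := sSup ((fun t => ‖D t‖) '' Iio T) with hN
  have hbdd : BddAbove ((fun t => ‖D t‖) '' Iio T) :=
    ⟨M, by rintro _ ⟨s, hs, rfl⟩; exact hM s hs⟩
  have hle : ∀ s < T, ‖D s‖ ≤ N := fun s hs => le_csSup hbdd ⟨s, hs, rfl⟩
  -- Inserting the supremum `N` into its own estimate gives a linear inequality, solvable for `N`
  -- because `k < K`.
  have hN2 : N ≤ (H + k * N) / K := by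
    refine csSup_le ⟨_, t, ht, rfl⟩ ?_
    rintro _ ⟨s, hs, rfl⟩
    refine norm_le_div_of_hasDerivAt_damped (hk.trans_lt hkK) hD (fun τ hτ => ?_) hle hs
    exact (hg τ hτ).trans (by gcongr; exact hle τ hτ)
  refine (hle t ht).trans ?_
  rw [le_div_iff₀ (hk.trans_lt hkK)] at hN2
  rw [le_div_iff₀ (by linarith)]
  linarith

variable [CompleteSpace E]

/-- The solution is the Duhamel integral started at `-∞`, namely `∫ exp (-K (t - s)) g(s) ds` over
`s ≤ t`. -/
lemma exists_hasDerivAt_damped {K R : ℝ} (hK : 0 < K) {g : ℝ → E} (hg : Continuous g)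
    (hR : ∀ t, ‖g t‖ ≤ R) :
    ∃ D : ℝ → E, (∀ t, HasDerivAt D (-(K • D t) + g t) t) ∧ ∀ t, ‖D t‖ ≤ R / K := by
  have hint : ∀ t, MeasureTheory.IntegrableOn (fun s => Real.exp (K * s)) (Iic t) := fun t =>
    integrableOn_exp_mul_Iic hK t
  have hcont : Continuous fun s => Real.exp (K * s) • g s := by fun_prop
  have hbd : ∀ s, ‖Real.exp (K * s) • g s‖ ≤ Real.exp (K * s) * R := fun s => by
    rw [norm_smul, Real.norm_of_nonneg (Real.exp_pos _).le]
    exact mul_le_mul_of_nonneg_left (hR s) (Real.exp_pos _).le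
  have hintg : ∀ t, MeasureTheory.IntegrableOn (fun s => Real.exp (K * s) • g s) (Iic t) :=
    fun t => ((hint t).mul_const R).mono' hcont.aestronglyMeasurable
      (Eventually.of_forall hbd)
  set I : ℝ → E := fun t => ∫ s in Iic t, Real.exp (K * s) • g s with hI
  have hId : ∀ t, HasDerivAt I (Real.exp (K * t) • g t) t := fun t => by
    have h1 : I = fun t => I 0 + ∫ s in (0 : ℝ)..t, Real.exp (K * s) • g s := by
      ext t
      rw [← intervalIntegral.integral_Iic_sub_Iic (hintg 0) (hintg t)]
      simp [hI]
    rw [h1]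
    exact (intervalIntegral.integral_hasDerivAt_right (hcont.intervalIntegrable _ _)
      (hcont.stronglyMeasurableAtFilter _ _) hcont.continuousAt).const_add _
  refine ⟨fun t => Real.exp (-(K * t)) • I t, fun t => ?_, fun t => ?_⟩
  · have he : HasDerivAt (fun t => Real.exp (-(K * t))) (Real.exp (-(K * t)) * -K) t := by
      simpa using (((hasDerivAt_id t).const_mul K).neg).exp
    refine (he.smul (hId t)).congr_deriv ?_
    rw [smul_smul (Real.exp (-(K * t))), ← Real.exp_add, neg_add_cancel, Real.exp_zero]
    module
  · rw [norm_smul, Real.norm_of_nonneg (Real.exp_pos _).le]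
    have h1 : ‖I t‖ ≤ Real.exp (K * t) / K * R := by
      refine (MeasureTheory.norm_integral_le_of_norm_le ((hint t).mul_const R)
        (Eventually.of_forall hbd)).trans ?_
      rw [MeasureTheory.integral_mul_const, integral_exp_mul_Iic hK]
    calc Real.exp (-(K * t)) * ‖I t‖ ≤ Real.exp (-(K * t)) * (Real.exp (K * t) / K * R) := by
          gcongr
      _ = (Real.exp (-(K * t)) * Real.exp (K * t)) * (R / K) := by ring
      _ = R / K := by rw [← Real.exp_add, neg_add_cancel, Real.exp_zero, one_mul]

/-- The equation `y' = -K y + G(t, y)` has a bounded solution on the whole line if `G` is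
Lipschitz in `y` with a constant smaller than `K` and `G(t, 0)` is bounded. -/
lemma exists_bounded_solution {K k H : ℝ} (hk : 0 ≤ k) (hkK : k < K) {G : ℝ → E → E}
    (hG : Continuous fun z : ℝ × E => G z.1 z.2) (hlip : ∀ t y z, ‖G t y - G t z‖ ≤ k * ‖y - z‖)
    (hH : ∀ t, ‖G t 0‖ ≤ H) :
    ∃ y : ℝ → E, (∀ t, HasDerivAt y (-(K • y t) + G t (y t)) t) ∧ ∃ M, ∀ t, ‖y t‖ ≤ M := by
  have hK : 0 < K := hk.trans_lt hkK
  have hGb : ∀ t y, ‖G t y‖ ≤ H + k * ‖y‖ := fun t y => by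
    have h1 := hlip t y 0
    have h2 := norm_le_norm_add_norm_sub' (G t y) (G t 0)
    rw [sub_zero] at h1
    linarith [hH t]
  have hex : ∀ y : BoundedContinuousFunction ℝ E, ∃ D : BoundedContinuousFunction ℝ E,
      ∀ t, HasDerivAt D (-(K • D t) + G t (y t)) t := fun y => by
    obtain ⟨D, hD, hDb⟩ := exists_hasDerivAt_damped hK
      (hG.comp (continuous_id.prodMk y.continuous)) (R := H + k * ‖y‖)
      (fun t => (hGb t (y t)).trans (by gcongr; exact y.norm_coe_le_norm t))
    exact ⟨BoundedContinuousFunction.ofNormedAddCommGroup D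
      (continuous_iff_continuousAt.2 fun t => (hD t).continuousAt) _ hDb, hD⟩
  choose Φ hΦ using hex
  -- `Φ y` is the bounded solution with forcing `G(t, y(t))`. Changing `y` changes the forcing by at
  -- most `k ‖y - z‖`, and the damping divides this by `K`.
  have hcontr : ContractingWith (NNReal.mk (k / K) (by positivity)) Φ := by
    refine ⟨?_, LipschitzWith.of_dist_le_mul fun y z => ?_⟩
    · rw [← NNReal.coe_lt_coe]
      exact (div_lt_one hK).2 hkK
    · rw [NNReal.coe_mk, BoundedContinuousFunction.dist_le (by positivity)]
      intro t
      rw [dist_eq_norm]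
      have := norm_le_div_of_hasDerivAt_damped (T := t + 1) (R := k * dist y z)
        (M := ‖Φ y - Φ z‖) (D := fun t => Φ y t - Φ z t)
        (g := fun t => G t (y t) - G t (z t)) hK (fun s _ => by
          exact ((hΦ y s).sub (hΦ z s)).congr_deriv (by module))
        (fun s _ => (hlip s _ _).trans (by
          gcongr; rw [← dist_eq_norm]; exact BoundedContinuousFunction.dist_coe_le_dist s))
        (fun s _ => (Φ y - Φ z).norm_coe_le_norm s) (lt_add_one t)
      calc _ ≤ _ := this
        _ = _ := by ring
  have hfix : Φ hcontr.fixedPoint = hcontr.fixedPoint := hcontr.fixedPoint_isFixedPt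
  refine ⟨hcontr.fixedPoint, fun t => ?_, _, fun t => hcontr.fixedPoint.norm_coe_le_norm t⟩
  have := hΦ hcontr.fixedPoint t
  rwa [hfix] at this

end LinearlyDamped

/-! ### Existence and uniqueness of the pullback attractor. -/

section PullbackAttractor

variable {n : ℕ} {U : Set (Fin n → ℝ)} {f : (Fin n → ℝ) → ℝ → (Fin n → ℝ)}

lemma zero_div_pi (w : Fin n → ℝ) : (0 : Fin n → ℝ) / w = 0 := by
  ext i; simp

/-- Row `i` of `K + A` has nonnegative entries. Its action on a vector bounded by `m w` is therefore
bounded by its action on `m w` itself. -/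
lemma abs_mulVec_le_of_metzler {A : Matrix (Fin n) (Fin n) ℝ} (hoff : ∀ i j, i ≠ j → 0 ≤ A i j)
    {K : ℝ} {w d : Fin n → ℝ} (hw : StrongLT 0 w) {i : Fin n} (hK : 0 ≤ K + A i i) {m : ℝ}
    (hd : ∀ j, |d j| ≤ m) :
    |K * (w i * d i) + A.mulVec (w * d) i| ≤ (K * w i + A.mulVec w i) * m := by
  have h1 : K * (w i * d i) + A.mulVec (w * d) i = (K + A i i) * w i * d i
      + ∑ j ∈ Finset.univ.erase i, A i j * w j * d j := by
    rw [mulVec_apply_eq_add_sum_erase]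
    simp only [Pi.mul_apply, mul_assoc]
    ring
  have h2 : (K * w i + A.mulVec w i) * m = (K + A i i) * w i * m
      + ∑ j ∈ Finset.univ.erase i, A i j * w j * m := by
    rw [mulVec_apply_eq_add_sum_erase, ← Finset.sum_mul]
    ring
  rw [h1, h2]
  refine (abs_add_le _ _).trans (add_le_add ?_ ((Finset.abs_sum_le_sum_abs _ _).trans
    (Finset.sum_le_sum fun j hj => ?_)))
  · rw [abs_mul, abs_of_nonneg (mul_nonneg hK (hw i).le)]
    exact mul_le_mul_of_nonneg_left (hd i) (mul_nonneg hK (hw i).le)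
  · have h3 : 0 ≤ A i j * w j :=
      mul_nonneg (hoff i j (Finset.ne_of_mem_erase hj).symm) (hw j).le
    rw [abs_mul, abs_of_nonneg h3]
    exact mul_le_mul_of_nonneg_left (hd j) h3

/-- In coordinates scaled by `w`, the field shifted by a large multiple of the identity is a
contraction relative to this multiple near an attracting equilibrium. -/
lemma exists_scaled_lipschitz (hU : IsOpen U)
    (hf : ContDiffOn ℝ 2 (fun z : (Fin n → ℝ) × ℝ => f z.1 z.2) (U ×ˢ univ)) {lm : ℝ}
    {I : Set ℝ} (hmono : ∀ l ∈ I, IsMonotoneSystem U (fun x => f x l))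
    {q w : Fin n → ℝ} (hq : q ∈ U) (hw : StrongLT 0 w)
    (hAw : StrongLT ((jacobian (fun x => f x lm) q).mulVec w) 0) :
    ∃ K k ρ δ : ℝ, 0 ≤ k ∧ k < K ∧ 0 < ρ ∧ 0 < δ ∧ ∀ l ∈ I, |l - lm| < δ →
      ∀ y z : Fin n → ℝ, ‖y‖ ≤ ρ → ‖z‖ ≤ ρ → q + w * y ∈ U ∧
      ‖(K • y + f (q + w * y) l / w) - (K • z + f (q + w * z) l / w)‖ ≤ k * ‖y - z‖ := by
  set A := jacobian (fun x => f x lm) q with hA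
  obtain ⟨c, hc, hc0⟩ : ∃ c : ℝ, (∀ i, A.mulVec w i < -c * w i) ∧ 0 < c := by
    have : ∀ᶠ c : ℝ in 𝓝[>] 0, ∀ i, A.mulVec w i < -c * w i := by
      refine eventually_all.2 fun i => ?_
      have hcont : Tendsto (fun c : ℝ => -c * w i) (𝓝[>] 0) (𝓝 (-0 * w i)) :=
        (Continuous.tendsto (by fun_prop) 0).mono_left nhdsWithin_le_nhds
      exact hcont.eventually_const_lt (by simpa using hAw i)
    exact (this.and self_mem_nhdsWithin).exists
  -- This choice makes the diagonal of `K + A` positive. Together with `A w < -c w`, both strict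
  -- inequalities persist for nearby points and parameters.
  set K : ℝ := 1 + ∑ i, |A i i| with hK
  have hK0 : 0 < K := by
    have : 0 ≤ ∑ i, |A i i| := Finset.sum_nonneg fun _ _ => abs_nonneg _
    linarith
  have hKA : ∀ i, 0 < K + A i i := fun i => by
    have h1 := Finset.single_le_sum (f := fun i => |A i i|) (fun _ _ => abs_nonneg _)
      (Finset.mem_univ i)
    have h2 := neg_abs_le (A i i)
    have h3 : |A i i| ≤ ∑ i, |A i i| := h1
    linarith
  have hev : ∀ᶠ z : (Fin n → ℝ) × ℝ in 𝓝 (q, lm), z.1 ∈ U ∧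
      ∀ i, 0 < K + jacobian (fun x => f x z.2) z.1 i i ∧
        (jacobian (fun x => f x z.2) z.1).mulVec w i < -c * w i := by
    have hJ := continuousAt_jacobian hU hf hq lm
    have h1 : ∀ᶠ z : (Fin n → ℝ) × ℝ in 𝓝 (q, lm), z.1 ∈ U :=
      continuous_fst.continuousAt.eventually (hU.mem_nhds hq)
    refine h1.and (eventually_all.2 fun i => Eventually.and ?_ ?_)
    · have : ContinuousAt (fun M : Matrix (Fin n) (Fin n) ℝ => K + M i i) A :=
        (continuous_const.add (continuous_id.matrix_elem i i)).continuousAt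
      exact (this.comp (f := fun z : (Fin n → ℝ) × ℝ => jacobian (fun x => f x z.2) z.1)
        (x := (q, lm)) hJ).eventually_const_lt (hKA i)
    · have : ContinuousAt (fun M : Matrix (Fin n) (Fin n) ℝ => M.mulVec w i) A := by
        fun_prop
      exact (this.comp (f := fun z : (Fin n → ℝ) × ℝ => jacobian (fun x => f x z.2) z.1)
        (x := (q, lm)) hJ).eventually_lt_const (hc i)
  have hev2 : ∀ᶠ z : (Fin n → ℝ) × ℝ in 𝓝 (0, lm), q + w * z.1 ∈ U ∧
      ∀ i, 0 < K + jacobian (fun x => f x z.2) (q + w * z.1) i i ∧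
        (jacobian (fun x => f x z.2) (q + w * z.1)).mulVec w i < -c * w i := by
    have : Tendsto (fun z : (Fin n → ℝ) × ℝ => (q + w * z.1, z.2)) (𝓝 (0, lm)) (𝓝 (q, lm)) := by
      have h : Continuous (fun z : (Fin n → ℝ) × ℝ => (q + w * z.1, z.2)) := by fun_prop
      simpa using h.tendsto (0, lm)
    exact this.eventually hev
  obtain ⟨ε, hε, hball⟩ := Metric.eventually_nhds_iff.1 hev2
  -- The Lipschitz constant is `K - c`, since `(K + A) w < (K - c) w` near `q`. The `max` only
  -- secures `0 ≤ k`.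
  refine ⟨K, max (K - c) 0, ε / 2, ε, le_max_right _ _, max_lt (by linarith) hK0, by positivity,
    hε, fun l hl hll y z hy hz => ?_⟩
  have hin : ∀ y : Fin n → ℝ, ‖y‖ ≤ ε / 2 → q + w * y ∈ U ∧
      ∀ i, 0 < K + jacobian (fun x => f x l) (q + w * y) i i ∧
        (jacobian (fun x => f x l) (q + w * y)).mulVec w i < -c * w i := fun y hy =>
    hball (y := (y, l)) (by
      rw [Prod.dist_eq, max_lt_iff, dist_zero_right, Real.dist_eq]
      exact ⟨by linarith, hll⟩)
  have hseg : ∀ x ∈ segment ℝ (q + w * z) (q + w * y), ∃ d, ‖d‖ ≤ ε / 2 ∧ x = q + w * d := by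
    rintro x ⟨a, b, ha, hb, hab, rfl⟩
    refine ⟨a • z + b • y, ?_, ?_⟩
    · simpa using (convex_closedBall (0 : Fin n → ℝ) (ε / 2)) (by simpa using hz)
        (by simpa using hy) ha hb hab
    · ext i
      simp only [Pi.add_apply, Pi.smul_apply, Pi.mul_apply, smul_eq_mul]
      linear_combination (q i) * hab
  refine ⟨(hin y hy).1, ?_⟩
  rw [pi_norm_le_iff_of_nonneg (by positivity)]
  intro i
  obtain ⟨x, hx, hmv⟩ := exists_sub_eq_jacobian_mulVec hU hf
    (x := q + w * z) (y := q + w * y) (fun x hx => by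
      obtain ⟨d, hd, rfl⟩ := hseg x hx; exact (hin d hd).1) l i
  obtain ⟨d, hd, rfl⟩ := hseg x hx
  obtain ⟨hU', hJ⟩ := hin d hd
  have hwi : 0 < w i := hw i
  have hsub : q + w * y - (q + w * z) = w * (y - z) := by ring
  rw [hsub] at hmv
  have habs := abs_mulVec_le_of_metzler (hmono l hl _ hU') hw (hJ i).1.le (m := ‖y - z‖)
    (d := y - z) (fun j => norm_le_pi_norm (y - z) j)
  rw [← hmv] at habs
  have hrew : ((K • y + f (q + w * y) l / w) - (K • z + f (q + w * z) l / w)) i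
      = (K * (w i * (y - z) i) + (f (q + w * y) l i - f (q + w * z) l i)) / w i := by
    simp only [Pi.add_apply, Pi.sub_apply, Pi.smul_apply, Pi.div_apply, smul_eq_mul]
    field_simp
    ring
  rw [hrew, Real.norm_eq_abs, abs_div, abs_of_pos hwi, div_le_iff₀ hwi]
  refine habs.trans ?_
  have h1 := (hJ i).2
  have h2 : K * w i + (jacobian (fun x => f x l) (q + w * d)).mulVec w i
      ≤ max (K - c) 0 * w i := by
    have := mul_le_mul_of_nonneg_right (le_max_left (K - c) 0) hwi.le
    linarith
  calc _ ≤ max (K - c) 0 * w i * ‖y - z‖ := mul_le_mul_of_nonneg_right h2 (norm_nonneg _)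
    _ = _ := by ring

/-- The coordinatewise projection onto the ball of radius `ρ` in the supremum norm. -/
noncomputable def clamp (ρ : ℝ) (hρ : -ρ ≤ ρ) (y : Fin n → ℝ) : Fin n → ℝ := fun i => projIcc (-ρ) ρ hρ (y i)

lemma norm_clamp_le {ρ : ℝ} (hρ : -ρ ≤ ρ) (y : Fin n → ℝ) : ‖clamp ρ hρ y‖ ≤ ρ := by
  refine (pi_norm_le_iff_of_nonneg (by linarith)).2 fun i => ?_
  rw [Real.norm_eq_abs, abs_le]
  exact (projIcc (-ρ) ρ hρ (y i)).2

lemma norm_clamp_sub_le {ρ : ℝ} (hρ : -ρ ≤ ρ) (y z : Fin n → ℝ) :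
    ‖clamp ρ hρ y - clamp ρ hρ z‖ ≤ ‖y - z‖ := by
  refine (pi_norm_le_iff_of_nonneg (norm_nonneg _)).2 fun i => ?_
  refine le_trans ?_ (norm_le_pi_norm (y - z) i)
  have := (LipschitzWith.projIcc hρ).dist_le_mul (y i) (z i)
  simpa [Subtype.dist_eq, Real.dist_eq, clamp] using this

lemma clamp_of_norm_le {ρ : ℝ} (hρ : -ρ ≤ ρ) {y : Fin n → ℝ} (hy : ‖y‖ ≤ ρ) :
    clamp ρ hρ y = y := by
  ext i
  have : y i ∈ Icc (-ρ) ρ := abs_le.1 ((norm_le_pi_norm y i).trans hy)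
  simp [clamp, projIcc_of_mem hρ this]

lemma continuous_clamp {ρ : ℝ} (hρ : -ρ ≤ ρ) :
    Continuous (clamp ρ hρ : (Fin n → ℝ) → (Fin n → ℝ)) :=
  continuous_pi fun i => continuous_subtype_val.comp
    (continuous_projIcc.comp (continuous_apply i))

section

variable (hU : IsOpen U)
  (hf : ContDiffOn ℝ 2 (fun z : (Fin n → ℝ) × ℝ => f z.1 z.2) (U ×ˢ univ)) {lm : ℝ}
  {I : Set ℝ} (hmono : ∀ l ∈ I, IsMonotoneSystem U (fun x => f x l))
  {q w : Fin n → ℝ} (hq : q ∈ U) (hq0 : f q lm = 0) (hw : StrongLT 0 w)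
  (hAw : StrongLT ((jacobian (fun x => f x lm) q).mulVec w) 0)
  {L : ℝ → ℝ} (hL : Continuous L) (hLI : ∀ s, L s ∈ I) (hLlim : Tendsto L atBot (𝓝 lm))
  {r : ℝ} (hr : 0 < r)

include hU hf hmono hq hq0 hw hAw hL hLI hLlim hr in
-- Writing `x = q + w y`, the field is modified far from `y = 0` and after `T₀` so that the
-- Lipschitz bound becomes global. The bounded solution of the modified equation is small near `-∞`,
-- where the modification has no effect.
lemma exists_isPullbackTrajectory :
    ∃ (T : ℝ) (x : ℝ → (Fin n → ℝ)), IsPullbackTrajectory U f L r q (Iio T) x := by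
  obtain ⟨K, k, ρ, δ, hk, hkK, hρ, hδ, hlip⟩ := exists_scaled_lipschitz hU hf hmono hq hw hAw
  have hρ' : -ρ ≤ ρ := by linarith
  set l : ℝ → ℝ := fun t => L (r * t) with hl
  have hlc : Continuous l := by fun_prop
  have hllim : Tendsto l atBot (𝓝 lm) := hLlim.comp (tendsto_id.const_mul_atBot hr)
  set h : ℝ → (Fin n → ℝ) → (Fin n → ℝ) := fun t y => f (q + w * y) (l t) / w with hh
  have hw0 : ∀ i, w i ≠ 0 := fun i => (hw i).ne'
  have hdivc : Continuous fun v : Fin n → ℝ => v / w := by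
    refine continuous_pi fun i => ?_
    simp only [Pi.div_apply]
    fun_prop
  have hlim : Tendsto (fun t => ‖h t 0‖) atBot (𝓝 0) := by
    have h1 : Tendsto (fun t => f q (l t)) atBot (𝓝 (f q lm)) :=
      (continuousAt_uncurry hU hf hq lm).tendsto.comp (tendsto_const_nhds.prodMk_nhds hllim)
    have h2 := (hdivc.norm.tendsto _).comp h1
    simp only [hq0, zero_div_pi, norm_zero] at h2
    simpa [hh, Function.comp_def] using h2
  obtain ⟨T₀, hT₀⟩ := eventually_atBot.1
    ((Metric.tendsto_nhds.1 hllim δ hδ).and (hlim.eventually_le_const one_pos))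
  set G : ℝ → (Fin n → ℝ) → (Fin n → ℝ) := fun t y =>
    K • clamp ρ hρ' y + h (min t T₀) (clamp ρ hρ' y) with hG
  have hnear : ∀ t, |l (min t T₀) - lm| < δ := fun t => (hT₀ _ (min_le_right _ _)).1
  have hGlip : ∀ t y z, ‖G t y - G t z‖ ≤ k * ‖y - z‖ := fun t y z =>
    (hlip _ (hLI _) (hnear t) _ _ (norm_clamp_le hρ' y) (norm_clamp_le hρ' z)).2.trans
      (mul_le_mul_of_nonneg_left (norm_clamp_sub_le hρ' y z) hk)
  have hclamp0 : clamp ρ hρ' (0 : Fin n → ℝ) = 0 := clamp_of_norm_le hρ' (by simpa using hρ.le)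
  have hG0 : ∀ t, G t 0 = h (min t T₀) 0 := fun t => by simp only [hG, hclamp0]; simp
  have hGb : ∀ t, ‖G t 0‖ ≤ 1 := fun t => by
    rw [hG0]; exact (hT₀ _ (min_le_right _ _)).2
  have hGc : Continuous fun z : ℝ × (Fin n → ℝ) => G z.1 z.2 := by
    have hcl : Continuous fun z : ℝ × (Fin n → ℝ) => clamp ρ hρ' z.2 :=
      (continuous_clamp hρ').comp continuous_snd
    refine (hcl.const_smul K).add (hdivc.comp ?_)
    refine hf.continuousOn.comp_continuous
      (f := fun z : ℝ × (Fin n → ℝ) => (q + w * clamp ρ hρ' z.2, l (min z.1 T₀)))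
      (by fun_prop) fun z => ⟨?_, mem_univ _⟩
    exact (hlip _ (hLI _) (hnear z.1) _ _ (norm_clamp_le hρ' z.2) (norm_clamp_le hρ' z.2)).1
  obtain ⟨y, hy, M, hM⟩ := exists_bounded_solution hk hkK hGc hGlip hGb
  -- On `(-∞, T)` the bound on `y` involves only the forcing `h t 0` before `T`, which tends to `0`
  -- because `q` is an equilibrium for `lm`.
  have hsmall : ∀ ε > 0, ∃ T, ∀ t < T, ‖y t‖ ≤ ε := fun ε hε => by
    obtain ⟨T, hT⟩ := eventually_atBot.1
      (hlim.eventually_le_const (mul_pos hε (sub_pos.2 hkK)))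
    refine ⟨min T T₀, fun t ht => ?_⟩
    have := norm_le_of_hasDerivAt_damped (H := ε * (K - k)) (T := min T T₀) (D := y)
      (g := fun t => G t (y t)) hk hkK (fun t _ => hy t) (fun s hs => ?_) (fun s _ => hM s) ht
    · rwa [mul_div_cancel_right₀ _ (sub_pos.2 hkK).ne'] at this
    · have h1 := hGlip s (y s) 0
      have h2 := norm_le_norm_add_norm_sub' (G s (y s)) (G s 0)
      have h3 : ‖G s 0‖ ≤ ε * (K - k) := by
        rw [hG0, min_eq_left (hs.le.trans (min_le_right _ _))]
        exact hT s (hs.le.trans (min_le_left _ _))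
      rw [sub_zero] at h1
      linarith
  obtain ⟨T₁, hT₁⟩ := hsmall ρ hρ
  refine ⟨min T₁ T₀, fun t => q + w * y t, fun t ht => ?_, fun t ht => ?_, ?_⟩
  · have ht' : t < T₁ := lt_of_lt_of_le ht (min_le_left _ _)
    exact (hlip _ (hLI _) (hnear t) _ _ (hT₁ t ht') (hT₁ t ht')).1
  · have ht' : t < T₁ := lt_of_lt_of_le ht (min_le_left _ _)
    have ht'' : t ≤ T₀ := (lt_of_lt_of_le ht (min_le_right _ _)).le
    have h1 := ((hy t).const_mul w).const_add q
    refine h1.congr_deriv ?_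
    simp only [hG, clamp_of_norm_le hρ' (hT₁ t ht'), min_eq_left ht'', hh]
    ext i
    have := hw0 i
    simp only [Pi.mul_apply, Pi.add_apply, Pi.neg_apply, Pi.smul_apply, Pi.div_apply, smul_eq_mul]
    field_simp
    ring
  · have h0 : Tendsto y atBot (𝓝 0) := by
      rw [tendsto_zero_iff_norm_tendsto_zero, Metric.tendsto_nhds]
      intro ε hε
      obtain ⟨T, hT⟩ := hsmall (ε / 2) (by positivity)
      filter_upwards [eventually_lt_atBot T] with t ht
      have := hT t ht
      simp only [dist_zero_right, norm_norm]
      linarith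
    simpa using (h0.const_mul w).const_add q

include hU hf hmono hq hw hAw hLI hLlim hr in
-- In the scaled coordinates the difference of the two trajectories is a bounded solution of a
-- damped equation with `H = 0`, hence zero near `-∞`.
lemma eventually_eq_of_isPullbackTrajectory {T : ℝ} {x₁ x₂ : ℝ → (Fin n → ℝ)}
    (h₁ : IsPullbackTrajectory U f L r q (Iio T) x₁)
    (h₂ : IsPullbackTrajectory U f L r q (Iio T) x₂) : ∀ᶠ t in atBot, x₁ t = x₂ t := by
  obtain ⟨K, k, ρ, δ, hk, hkK, hρ, hδ, hlip⟩ := exists_scaled_lipschitz hU hf hmono hq hw hAw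
  have hllim : Tendsto (fun t => L (r * t)) atBot (𝓝 lm) :=
    hLlim.comp (tendsto_id.const_mul_atBot hr)
  have hw0 : ∀ i, w i ≠ 0 := fun i => (hw i).ne'
  have hdiv : ∀ x : Fin n → ℝ, q + w * ((x - q) / w) = x := fun x => by
    ext i
    have := hw0 i
    simp only [Pi.add_apply, Pi.mul_apply, Pi.div_apply, Pi.sub_apply]
    field_simp
    ring
  have hscale : ∀ x, IsPullbackTrajectory U f L r q (Iio T) x →
      ∀ᶠ t in atBot, ‖(x t - q) / w‖ ≤ ρ := fun x hx => by
    have hdivc : Continuous fun v : Fin n → ℝ => (v - q) / w := by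
      refine continuous_pi fun i => ?_
      simp only [Pi.div_apply]
      fun_prop
    have := (hdivc.norm.tendsto q).comp hx.tendsto_atBot
    rw [sub_self, zero_div_pi, norm_zero] at this
    exact this.eventually_le_const hρ
  obtain ⟨T₀, hT₀⟩ := eventually_atBot.1 ((hscale x₁ h₁).and ((hscale x₂ h₂).and
    ((Metric.tendsto_nhds.1 hllim δ hδ).and (eventually_lt_atBot T))))
  have hder : ∀ x, IsPullbackTrajectory U f L r q (Iio T) x → ∀ t < T₀,
      HasDerivAt (fun t => (x t - q) / w) (f (x t) (L (r * t)) / w) t := fun x hx t ht => by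
    refine hasDerivAt_pi.2 fun i => ?_
    exact ((hasDerivAt_pi.1 (hx.hasDerivAt t (hT₀ t ht.le).2.2.2) i).sub_const (q i)).div_const
      (w i)
  filter_upwards [eventually_lt_atBot T₀] with t ht
  have := norm_le_of_hasDerivAt_damped (K := K) (k := k) (H := 0) (T := T₀) (M := 2 * ρ)
    (D := fun t => (x₁ t - q) / w - (x₂ t - q) / w)
    (g := fun t => (K • ((x₁ t - q) / w) + f (q + w * ((x₁ t - q) / w)) (L (r * t)) / w)
      - (K • ((x₂ t - q) / w) + f (q + w * ((x₂ t - q) / w)) (L (r * t)) / w)) hk hkK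
    (fun s hs => ((hder x₁ h₁ s hs).sub (hder x₂ h₂ s hs)).congr_deriv (by
      simp only [hdiv]; module))
    (fun s hs => by
      rw [zero_add]
      have hs' := hT₀ s hs.le
      exact (hlip _ (hLI _) hs'.2.2.1 _ _ hs'.1 hs'.2.1).2)
    (fun s hs => by
      have hs' := hT₀ s hs.le
      refine (norm_sub_le _ _).trans ?_
      linarith [hs'.1, hs'.2.1]) ht
  rw [zero_div, norm_le_zero_iff, sub_eq_zero] at this
  rw [← hdiv (x₁ t), this, hdiv]

include hU hf in
lemma eventuallyEq_nhds_of_hasDerivAt {l : ℝ → ℝ} (hl : Continuous l) {t : ℝ}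
    {x₁ x₂ : ℝ → (Fin n → ℝ)} (hx : x₁ t ∈ U)
    (h₁ : ∀ᶠ s in 𝓝 t, HasDerivAt x₁ (f (x₁ s) (l s)) s)
    (h₂ : ∀ᶠ s in 𝓝 t, HasDerivAt x₂ (f (x₂ s) (l s)) s) (heq : x₁ t = x₂ t) :
    x₁ =ᶠ[𝓝 t] x₂ := by
  obtain ⟨K, V, hV, hK⟩ := ((contDiffAt_uncurry hU hf hx (l t)).of_le
    (by norm_num : (1 : WithTop ℕ∞) ≤ 2)).exists_lipschitzOnWith
  have hmem : ∀ x : ℝ → (Fin n → ℝ), ContinuousAt x t → x t = x₁ t →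
      ∀ᶠ s in 𝓝 t, (x s, l s) ∈ V := fun x hx hxt => by
    have : Tendsto (fun s => (x s, l s)) (𝓝 t) (𝓝 (x₁ t, l t)) := by
      rw [← hxt]; exact hx.prodMk hl.continuousAt
    exact this hV
  refine ODE_solution_unique_of_eventually (v := fun s x => f x (l s))
    (s := fun s => {x | (x, l s) ∈ V}) (K := K) (Eventually.of_forall fun s => ?_)
    (h₁.and (hmem x₁ h₁.self_of_nhds.continuousAt rfl))
    (h₂.and (hmem x₂ h₂.self_of_nhds.continuousAt heq.symm)) heq
  intro a ha b hb
  have := hK ha hb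
  simpa [Prod.edist_eq] using this

include hU hf hmono hq hq0 hw hAw hL hLI hLlim hr in
-- Agreement near `-∞` spreads to all of `(-∞, T)`: by local uniqueness, the set of times near which
-- the trajectories coincide is open and relatively closed in a connected set.
theorem hasPullbackAttractor : HasPullbackAttractor U f L r q := by
  refine ⟨exists_isPullbackTrajectory hU hf hmono hq hq0 hw hAw hL hLI hLlim hr,
    fun T x₁ x₂ h₁ h₂ => ?_⟩
  obtain ⟨T₀, hT₀⟩ := eventually_atBot.1
    (eventually_eq_of_isPullbackTrajectory hU hf hmono hq hw hAw hLI hLlim hr h₁ h₂)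
  have hlc : Continuous fun t => L (r * t) := by fun_prop
  have hsub : Iio T ⊆ {t | x₁ =ᶠ[𝓝 t] x₂} := by
    refine isPreconnected_Iio.subset_of_closure_inter_subset ?_ ?_ ?_
    · exact isOpen_setOfPred_eventually_nhds
    · refine ⟨min T T₀ - 1, ?_, ?_⟩
      · have := min_le_left T T₀
        simp only [mem_Iio]
        linarith
      · have : min T T₀ - 1 < T₀ := by linarith [min_le_right T T₀]
        filter_upwards [Iio_mem_nhds this] with s hs using hT₀ s (le_of_lt hs)
    · rintro t ⟨htc, ht⟩
      have hev : ∀ x, IsPullbackTrajectory U f L r q (Iio T) x →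
          ∀ᶠ s in 𝓝 t, HasDerivAt x (f (x s) (L (r * s))) s := fun x hx => by
        filter_upwards [Iio_mem_nhds ht] with s hs using hx.hasDerivAt s hs
      refine eventuallyEq_nhds_of_hasDerivAt hU hf hlc (h₁.mem t ht) (hev x₁ h₁) (hev x₂ h₂) ?_
      have hne := mem_closure_iff_nhdsWithin_neBot.1 htc
      refine tendsto_nhds_unique
        ((hev x₁ h₁).self_of_nhds.continuousAt.tendsto.mono_left nhdsWithin_le_nhds)
        (((hev x₂ h₂).self_of_nhds.continuousAt.tendsto.mono_left nhdsWithin_le_nhds).congr' ?_)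
        (l := 𝓝[{t | x₁ =ᶠ[𝓝 t] x₂}] t)
      filter_upwards [self_mem_nhdsWithin] with s hs using hs.self_of_nhds.symm
  exact fun t ht => (hsub ht).self_of_nhds

end

end PullbackAttractor

/-! ### Curves near a path along which the field is strictly positive. -/

section LowerCurves

variable {n : ℕ} {U : Set (Fin n → ℝ)} {f : (Fin n → ℝ) → ℝ → (Fin n → ℝ)}

/-- A compact continuous family of equilibria can be pushed into directions from an open convex
cone `C` along which the vector field becomes strictly positive. -/
lemma exists_pushed_family {S : Type*} [TopologicalSpace S] [CompactSpace S] [T2Space S]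
    (hU : IsOpen U) (hf : ContDiffOn ℝ 2 (fun z : (Fin n → ℝ) × ℝ => f z.1 z.2) (U ×ˢ univ))
    {X : S → (Fin n → ℝ)} {l : S → ℝ} (hX : Continuous X) (hl : Continuous l)
    (hXU : ∀ s, X s ∈ U) (hX0 : ∀ s, f (X s) (l s) = 0) {C : Set (Fin n → ℝ)} (hCo : IsOpen C)
    (hCc : Convex ℝ C) (hC : ∀ η : ℝ, 0 < η → ∀ v ∈ C, η • v ∈ C)
    (hdir : ∀ s, ∃ W ∈ C, StrongLT 0 ((jacobian (fun x => f x (l s)) (X s)).mulVec W))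
    {e : ℝ} (he : 0 < e) :
    ∃ (y : S → (Fin n → ℝ)) (ρ : ℝ), Continuous y ∧ 0 < ρ ∧ ∀ s z, ‖z - y s‖ < ρ →
      z ∈ U ∧ ‖z - X s‖ < e ∧ (∀ i, ρ < f z (l s) i) ∧ z - X s ∈ C := by
  have hJ : ∀ s, ContinuousAt (fun s => jacobian (fun x => f x (l s)) (X s)) s := fun s =>
    (continuousAt_jacobian hU hf (hXU s) (l s)).comp
      (f := fun s => (X s, l s)) (x := s) (hX.prodMk hl).continuousAt
  -- A direction admissible at `s` stays admissible nearby, and admissible directions form a convex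
  -- set, so local choices glue to a continuous `W`.
  obtain ⟨W, hW⟩ := exists_continuous_forall_mem_convex_of_local_const
    (t := fun s => {W | W ∈ C ∧ ∀ i, 0 < (jacobian (fun x => f x (l s)) (X s)).mulVec W i})
    (fun s => by
      refine hCc.inter ?_
      intro a ha b hb α β hα hβ hαβ i
      rw [Matrix.mulVec_add, Matrix.mulVec_smul, Matrix.mulVec_smul]
      exact (convex_Ioi (0 : ℝ)) (ha i) (hb i) hα hβ hαβ)
    (fun s => by
      obtain ⟨W, hWC, hW⟩ := hdir s
      refine ⟨W, Eventually.and (Eventually.of_forall fun _ => hWC) (eventually_all.2 fun i => ?_)⟩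
      have : ContinuousAt (fun M : Matrix (Fin n) (Fin n) ℝ => M.mulVec W i)
        (jacobian (fun x => f x (l s)) (X s)) := by fun_prop
      exact (this.comp (f := fun s => jacobian (fun x => f x (l s)) (X s))
        (x := s) (hJ s)).eventually_const_lt (hW i))
  -- Since `X s` is an equilibrium, the mean value theorem gives each component of the field at `X s
  -- + η W s` as `η` times a positive number. Compactness makes the range of `η` uniform in `s`.
  have hη : ∀ᶠ η : ℝ in 𝓝 0, ∀ s ∈ (univ : Set S), 0 < η → X s + η • W s ∈ U ∧
      ‖η • W s‖ < e ∧ ∀ i, 0 < f (X s + η • W s) (l s) i := by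
    refine isCompact_univ.eventually_forall_of_forall_eventually fun s _ => ?_
    have hev : ∀ᶠ z : (Fin n → ℝ) × S in 𝓝 (X s, s), z.1 ∈ U ∧
        ∀ i, 0 < (jacobian (fun x => f x (l z.2)) z.1).mulVec (W z.2) i := by
      refine (continuous_fst.continuousAt.eventually (hU.mem_nhds (hXU s))).and
        (eventually_all.2 fun i => ?_)
      have h1 : ContinuousAt (fun z : (Fin n → ℝ) × S => jacobian (fun x => f x (l z.2)) z.1)
          (X s, s) :=
        (continuousAt_jacobian hU hf (hXU s) (l s)).comp
          (f := fun z : (Fin n → ℝ) × S => (z.1, l z.2)) (x := (X s, s))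
          (continuous_fst.prodMk (hl.comp continuous_snd)).continuousAt
      have h2 : ContinuousAt (fun z : (Fin n → ℝ) × S => W z.2) (X s, s) := by fun_prop
      have h4 : Continuous fun p : Matrix (Fin n) (Fin n) ℝ × (Fin n → ℝ) => p.1.mulVec p.2 i :=
        (continuous_apply i).comp (continuous_fst.matrix_mulVec continuous_snd)
      have h3 : ContinuousAt (fun z : (Fin n → ℝ) × S =>
          (jacobian (fun x => f x (l z.2)) z.1).mulVec (W z.2) i) (X s, s) :=
        h4.continuousAt.comp (f := fun z : (Fin n → ℝ) × S =>
          (jacobian (fun x => f x (l z.2)) z.1, W z.2)) (h1.prodMk h2)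
      exact h3.eventually_const_lt ((hW s).2 i)
    obtain ⟨V, hV, N, hN, hVN⟩ := mem_nhds_prod_iff.1 hev
    obtain ⟨d, hd, hdV⟩ := Metric.mem_nhds_iff.1 hV
    have hc1 : Continuous fun z : ℝ × S => ‖X z.2 - X s‖ := by fun_prop
    have hc2 : Continuous fun z : ℝ × S => ‖X z.2 + z.1 • W z.2 - X s‖ := by fun_prop
    have hc3 : Continuous fun z : ℝ × S => ‖z.1 • W z.2‖ := by fun_prop
    have e1 := (hc1.tendsto ((0 : ℝ), s)).eventually_lt_const (u := d) (by simpa using hd)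
    have e2 := (hc2.tendsto ((0 : ℝ), s)).eventually_lt_const (u := d) (by simpa using hd)
    have e3 := (hc3.tendsto ((0 : ℝ), s)).eventually_lt_const (u := e) (by simpa using he)
    have e4 : ∀ᶠ z : ℝ × S in 𝓝 (0, s), z.2 ∈ N := continuous_snd.continuousAt.eventually hN
    filter_upwards [e1, e2, e3, e4] with ⟨η, s'⟩ h1 h2 h3 h4 hη
    simp only at h1 h2 h3 h4 hη ⊢
    have hseg : ∀ x ∈ segment ℝ (X s') (X s' + η • W s'), x ∈ V := fun x hx =>
      hdV ((convex_ball (X s) d).segment_subset (by simpa [dist_eq_norm] using h1)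
        (by simpa [dist_eq_norm] using h2) hx)
    have hsegU : segment ℝ (X s') (X s' + η • W s') ⊆ U := fun x hx =>
      (hVN (mk_mem_prod (hseg x hx) h4)).1
    refine ⟨hsegU (right_mem_segment ℝ _ _), h3, fun i => ?_⟩
    obtain ⟨x, hx, hmv⟩ := exists_sub_eq_jacobian_mulVec hU hf hsegU (l s') i
    rw [hX0, add_sub_cancel_left, Matrix.mulVec_smul] at hmv
    have := (hVN (mk_mem_prod (hseg x hx) h4)).2 i
    simp only [Pi.zero_apply, sub_zero, Pi.smul_apply, smul_eq_mul] at hmv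
    rw [hmv]
    exact mul_pos hη this
  obtain ⟨η, hη, hη0⟩ := ((hη.filter_mono nhdsWithin_le_nhds).and
    (self_mem_nhdsWithin (a := (0 : ℝ)) (s := Ioi 0))).exists
  have hη0 : 0 < η := hη0
  set y : S → (Fin n → ℝ) := fun s => X s + η • W s with hy
  have hyc : Continuous y := by fun_prop
  -- All conditions are open, so they hold in a uniform tube around `y`. This leaves room to replace
  -- `y` by a Lipschitz curve.
  have htube : ∀ᶠ z : (Fin n → ℝ) × ℝ in 𝓝 (0, 0), ∀ s ∈ (univ : Set S),
      y s + z.1 ∈ U ∧ ‖y s + z.1 - X s‖ < e ∧ (∀ i, z.2 < f (y s + z.1) (l s) i) ∧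
        y s + z.1 - X s ∈ C := by
    refine isCompact_univ.eventually_forall_of_forall_eventually fun s _ => ?_
    obtain ⟨hyU, hye, hyf⟩ := hη s (mem_univ s) hη0
    have hc : Continuous fun z : ((Fin n → ℝ) × ℝ) × S => y z.2 + z.1.1 := by fun_prop
    have hc2 : Continuous fun z : ((Fin n → ℝ) × ℝ) × S => y z.2 + z.1.1 - X z.2 := by fun_prop
    refine Eventually.and ?_ (Eventually.and ?_ (Eventually.and (eventually_all.2 fun i => ?_) ?_))
    · exact hc.continuousAt.eventually (hU.mem_nhds (by simpa using hyU))
    · exact hc2.norm.continuousAt.eventually_lt_const (by simpa [hy] using hye)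
    · have h1 : ContinuousAt (fun z : ((Fin n → ℝ) × ℝ) × S => f (y z.2 + z.1.1) (l z.2) i)
          (((0 : Fin n → ℝ), (0 : ℝ)), s) := by
        have h2 : ContinuousAt (fun z : (Fin n → ℝ) × ℝ => f z.1 z.2 i)
            (y s + 0, l s) :=
          (continuous_apply i).continuousAt.comp
            (continuousAt_uncurry hU hf (by simpa using hyU) (l s))
        exact h2.comp (f := fun z : ((Fin n → ℝ) × ℝ) × S => (y z.2 + z.1.1, l z.2))
          (x := (((0 : Fin n → ℝ), (0 : ℝ)), s))
          (hc.prodMk (hl.comp continuous_snd)).continuousAt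
      exact ContinuousAt.eventually_lt (by fun_prop) h1 (by simpa using hyf i)
    · refine hc2.continuousAt.eventually (hCo.mem_nhds ?_)
      simpa [hy] using hC η hη0 _ (hW s).1
  obtain ⟨ε, hε, hball⟩ := Metric.eventually_nhds_iff.1 htube
  refine ⟨y, ε / 2, hyc, by positivity, fun s z hz => ?_⟩
  have := hball (y := (z - y s, ε / 2)) (by
    rw [Prod.dist_eq, max_lt_iff, dist_zero_right, dist_zero_right, Real.norm_of_nonneg
      (by positivity)]
    exact ⟨by linarith, by linarith⟩) s (mem_univ s)
  simpa using this

/-- The extension of a curve on the real line to the extended real line by given end values. -/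
noncomputable def extend {E : Type*} (X : ℝ → E) (Xm Xp : E) (s : EReal) : E :=
  if s = ⊥ then Xm else if s = ⊤ then Xp else X s.toReal

@[simp] lemma extend_bot {E : Type*} (X : ℝ → E) (Xm Xp : E) : extend X Xm Xp ⊥ = Xm := by
  simp [extend]

@[simp] lemma extend_top {E : Type*} (X : ℝ → E) (Xm Xp : E) : extend X Xm Xp ⊤ = Xp := by
  simp [extend]

@[simp] lemma extend_coe {E : Type*} (X : ℝ → E) (Xm Xp : E) (s : ℝ) :
    extend X Xm Xp s = X s := by
  simp [extend]

lemma continuous_extend {E : Type*} [TopologicalSpace E] {X : ℝ → E} {Xm Xp : E}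
    (hX : Continuous X) (hm : Tendsto X atBot (𝓝 Xm)) (hp : Tendsto X atTop (𝓝 Xp)) :
    Continuous (extend X Xm Xp) := by
  refine continuous_iff_continuousAt.2 fun s => ?_
  induction s using EReal.rec with
  | bot =>
    refine continuousAt_iff_punctured_nhds.2 ?_
    rw [EReal.nhdsWithin_bot, tendsto_map'_iff, extend_bot]
    exact hm.congr fun s => (extend_coe X Xm Xp s).symm
  | top =>
    refine continuousAt_iff_punctured_nhds.2 ?_
    rw [EReal.nhdsWithin_top, tendsto_map'_iff, extend_top]
    exact hp.congr fun s => (extend_coe X Xm Xp s).symm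
  | coe s =>
    rw [ContinuousAt, EReal.nhds_coe, tendsto_map'_iff, extend_coe]
    exact (hX.tendsto s).congr fun s => (extend_coe X Xm Xp s).symm

/-- A curve on the line with limits at both ends is uniformly close to a Lipschitz curve that is
constant near both ends. -/
lemma exists_lipschitz_approx {Y : ℝ → (Fin n → ℝ)} {Ym Yp : Fin n → ℝ} (hY : Continuous Y)
    (hm : Tendsto Y atBot (𝓝 Ym)) (hp : Tendsto Y atTop (𝓝 Yp)) {ρ : ℝ} (hρ : 0 < ρ) :
    ∃ (y : ℝ → (Fin n → ℝ)) (ym yp : Fin n → ℝ) (K : NNReal), LipschitzWith K y ∧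
      (∀ s, ‖y s - Y s‖ < ρ) ∧ Tendsto y atBot (𝓝 ym) ∧ Tendsto y atTop (𝓝 yp) ∧
      ‖ym - Ym‖ < ρ ∧ ‖yp - Yp‖ < ρ := by
  have hρ4 : 0 < ρ / 4 := by positivity
  obtain ⟨a, ha⟩ := eventually_atBot.1 (Metric.tendsto_nhds.1 hm (ρ / 4) hρ4)
  obtain ⟨b', hb'⟩ := eventually_atTop.1 (Metric.tendsto_nhds.1 hp (ρ / 4) hρ4)
  set b := max a b' with hb
  have hab : a ≤ b := le_max_left _ _
  have hbp : ∀ s, b ≤ s → dist (Y s) Yp < ρ / 4 := fun s hs => hb' s ((le_max_right _ _).trans hs)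
  -- Weierstrass approximation on `[a, b]`, continued by constants through `projIcc`, gives a
  -- Lipschitz curve. Outside `[a, b]` the curve `Y` is already near its limits.
  choose P hP using fun i => exists_polynomial_near_of_continuousOn a b (fun s => Y s i)
    ((continuous_apply i).comp hY).continuousOn (ρ / 4) hρ4
  set p : ℝ → (Fin n → ℝ) := fun s i => (P i).eval s with hp'
  have hpY : ∀ s ∈ Icc a b, ‖p s - Y s‖ ≤ ρ / 4 := fun s hs =>
    (pi_norm_le_iff_of_nonneg hρ4.le).2 fun i => (hP i s hs).le
  have hpc : ContDiff ℝ 1 p := contDiff_pi.2 fun i => by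
    simpa [hp'] using (P i).contDiff_aeval (𝕜 := ℝ) 1
  obtain ⟨K, hK⟩ := hpc.contDiffOn.exists_lipschitzOnWith one_ne_zero
    (convex_Icc a b) isCompact_Icc
  refine ⟨fun s => p (projIcc a b hab s), p a, p b, K, ?_, fun s => ?_, ?_, ?_, ?_, ?_⟩
  · have := (lipschitzOnWith_iff_restrict.1 hK).comp (LipschitzWith.projIcc hab)
    rw [mul_one] at this
    exact this
  · simp only
    rcases le_total s a with hs | hs
    · rw [projIcc_of_le_left hab hs]
      have h1 := hpY a ⟨le_rfl, hab⟩
      have h2 := ha a le_rfl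
      have h3 := ha s hs
      have h4 := dist_triangle_right (Y a) (Y s) Ym
      rw [dist_eq_norm] at h4
      have h5 := norm_sub_le_norm_sub_add_norm_sub (p a) (Y a) (Y s)
      linarith
    rcases le_total b s with hs' | hs'
    · rw [projIcc_of_right_le hab hs']
      have h1 := hpY b ⟨hab, le_rfl⟩
      have h2 := hbp b le_rfl
      have h3 := hbp s hs'
      have h4 := dist_triangle_right (Y b) (Y s) Yp
      rw [dist_eq_norm] at h4
      have h5 := norm_sub_le_norm_sub_add_norm_sub (p b) (Y b) (Y s)
      linarith
    · rw [projIcc_of_mem hab ⟨hs, hs'⟩]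
      have := hpY s ⟨hs, hs'⟩
      linarith
  · refine tendsto_const_nhds.congr' ?_
    filter_upwards [eventually_le_atBot a] with s hs
    rw [projIcc_of_le_left hab hs]
  · refine tendsto_const_nhds.congr' ?_
    filter_upwards [eventually_ge_atTop b] with s hs
    rw [projIcc_of_right_le hab hs]
  · have h1 := hpY a ⟨le_rfl, hab⟩
    have h2 := ha a le_rfl
    rw [dist_eq_norm] at h2
    have h5 := norm_sub_le_norm_sub_add_norm_sub (p a) (Y a) Ym
    linarith
  · have h1 := hpY b ⟨hab, le_rfl⟩
    have h2 := hbp b le_rfl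
    rw [dist_eq_norm] at h2
    have h5 := norm_sub_le_norm_sub_add_norm_sub (p b) (Y b) Yp
    linarith

lemma IsPath.equilibrium_left {L : ℝ → ℝ} {X : ℝ → (Fin n → ℝ)} {Xm Xp : Fin n → ℝ} {lm : ℝ}
    (hU : IsOpen U) (hf : ContDiffOn ℝ 2 (fun z : (Fin n → ℝ) × ℝ => f z.1 z.2) (U ×ˢ univ))
    (h : IsPath U f L X Xm Xp) (hL : Tendsto L atBot (𝓝 lm)) : f Xm lm = 0 := by
  have h1 := (continuousAt_uncurry hU hf h.limit_mem_left lm).tendsto.comp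
    (h.tendsto_atBot.prodMk_nhds hL)
  exact tendsto_nhds_unique h1 (tendsto_const_nhds.congr fun s => (h.equilibrium s).symm)

lemma IsPath.equilibrium_right {L : ℝ → ℝ} {X : ℝ → (Fin n → ℝ)} {Xm Xp : Fin n → ℝ} {lp : ℝ}
    (hU : IsOpen U) (hf : ContDiffOn ℝ 2 (fun z : (Fin n → ℝ) × ℝ => f z.1 z.2) (U ×ˢ univ))
    (h : IsPath U f L X Xm Xp) (hL : Tendsto L atTop (𝓝 lp)) : f Xp lp = 0 := by
  have h1 := (continuousAt_uncurry hU hf h.limit_mem_right lp).tendsto.comp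
    (h.tendsto_atTop.prodMk_nhds hL)
  exact tendsto_nhds_unique h1 (tendsto_const_nhds.congr fun s => (h.equilibrium s).symm)

/-- Close to a path of equilibria there is a Lipschitz curve along which the vector field is
strictly positive, displaced from the path in directions from the cone `C` at both ends. -/
theorem IsPath.exists_lower_curve {L : ℝ → ℝ} {X : ℝ → (Fin n → ℝ)} {Xm Xp : Fin n → ℝ}
    {lm lp : ℝ} (hU : IsOpen U)
    (hf : ContDiffOn ℝ 2 (fun z : (Fin n → ℝ) × ℝ => f z.1 z.2) (U ×ˢ univ))
    (h : IsPath U f L X Xm Xp) (hL : Continuous L) (hLm : Tendsto L atBot (𝓝 lm))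
    (hLp : Tendsto L atTop (𝓝 lp)) {C : Set (Fin n → ℝ)} (hCo : IsOpen C)
    (hCc : Convex ℝ C) (hC : ∀ η : ℝ, 0 < η → ∀ v ∈ C, η • v ∈ C)
    (hdir : ∀ s, ∃ W ∈ C, StrongLT 0 ((jacobian (fun x => f x (L s)) (X s)).mulVec W))
    (hdirm : ∃ W ∈ C, StrongLT 0 ((jacobian (fun x => f x lm) Xm).mulVec W))
    (hdirp : ∃ W ∈ C, StrongLT 0 ((jacobian (fun x => f x lp) Xp).mulVec W))
    {e : ℝ} (he : 0 < e) :
    ∃ (y : ℝ → (Fin n → ℝ)) (ym yp : Fin n → ℝ) (K : NNReal) (ρ : ℝ), 0 < ρ ∧ LipschitzWith K y ∧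
      (∀ s, y s ∈ U ∧ ‖y s - X s‖ < e ∧ ∀ i, ρ < f (y s) (L s) i) ∧
      Tendsto y atBot (𝓝 ym) ∧ Tendsto y atTop (𝓝 yp) ∧ ym - Xm ∈ C ∧ yp - Xp ∈ C := by
  -- Adding the limits at both ends makes the parameter space the compact extended line, which is
  -- why conditions at the end equilibria are needed.
  obtain ⟨Y, ρ, hYc, hρ, hY⟩ := exists_pushed_family (S := EReal) hU hf
    (X := extend X Xm Xp) (l := extend L lm lp)
    (continuous_extend h.continuous h.tendsto_atBot h.tendsto_atTop)
    (continuous_extend hL hLm hLp)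
    (fun s => by
      induction s using EReal.rec with
      | bot => simpa using h.limit_mem_left
      | top => simpa using h.limit_mem_right
      | coe s => simpa using h.mem s)
    (fun s => by
      induction s using EReal.rec with
      | bot => simpa using h.equilibrium_left hU hf hLm
      | top => simpa using h.equilibrium_right hU hf hLp
      | coe s => simpa using h.equilibrium s) hCo hCc hC
    (fun s => by
      induction s using EReal.rec with
      | bot => simpa using hdirm
      | top => simpa using hdirp
      | coe s => simpa using hdir s) he
  obtain ⟨y, ym, yp, K, hK, hyY, hym, hyp, hm, hp⟩ := exists_lipschitz_approx
    (Y := fun s : ℝ => Y s) (hYc.comp continuous_coe_real_ereal)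
    ((hYc.tendsto ⊥).comp EReal.tendsto_coe_atBot) ((hYc.tendsto ⊤).comp EReal.tendsto_coe_atTop)
    hρ
  refine ⟨y, ym, yp, K, ρ, hρ, hK, fun s => ?_, hym, hyp, ?_, ?_⟩
  · have := hY s (y s) (hyY s)
    simp only [extend_coe] at this
    exact ⟨this.1, this.2.1, this.2.2.1⟩
  · simpa using (hY ⊥ ym hm).2.2.2
  · simpa using (hY ⊤ yp hp).2.2.2

end LowerCurves

/-! ### Tipping when `q` lies below `p`. -/

section Tipping

variable {n : ℕ} {U : Set (Fin n → ℝ)} {f : (Fin n → ℝ) → ℝ → (Fin n → ℝ)}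

/-- A trajectory stays above a strict lower solution up to time `t₀`, loses at most `M (t₁ - t₀)`
between `t₀` and `t₁`, and then stays above another strict lower solution. -/
lemma strongLT_of_three_phases (hU : IsOpen U) (hUc : PConvex U)
    (hf : ContDiffOn ℝ 2 (fun z : (Fin n → ℝ) × ℝ => f z.1 z.2) (U ×ˢ univ)) {I : Set ℝ}
    (hmono : ∀ l ∈ I, IsMonotoneSystem U (fun x => f x l)) {l : ℝ → ℝ} (hl : ∀ t, l t ∈ I)
    {x y z : ℝ → (Fin n → ℝ)} (hxU : ∀ t, x t ∈ U) (hx : ∀ t, HasDerivAt x (f (x t) (l t)) t)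
    {t₀ t₁ κ κ' M ρ : ℝ} (ht : t₀ ≤ t₁) (hy : IsStrictLower U f l (Iic t₀) κ y)
    (hyx : ∀ᶠ t in atBot, StrongLT (y t) (x t)) (hM : 0 ≤ M)
    (hball : ∀ c, ‖c - y t₀‖ ≤ ρ → c ∈ U ∧ ∀ a ∈ I, ∀ i, -M < f c a i)
    (hMρ : M * (t₁ - t₀) ≤ ρ) (hz : IsStrictLower U f l (Ici t₁) κ' z)
    (hzy : ∀ i, z t₁ i ≤ y t₀ i - M * (t₁ - t₀)) : ∀ t ≥ t₁, StrongLT (z t) (x t) := by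
  have h₀ : StrongLT (y t₀) (x t₀) := by
    obtain ⟨τ, hτ⟩ := eventually_atBot.1 hyx
    exact (hy.mono fun t ht => ht.2).strongLT hU hUc hf (t₀ := min τ t₀)
      (fun t _ => hmono _ (hl t)) (fun t _ => hxU t) (fun t _ => hx t)
      (hτ _ (min_le_left _ _)) t₀ ⟨min_le_right _ _, le_rfl⟩
  -- On the ball every component of the field exceeds `-M` for every parameter in `I`. A straight
  -- descent at speed `M` is thus a strict lower solution however the parameter moves; `hMρ` keeps
  -- it in the ball.
  set m : ℝ → (Fin n → ℝ) := fun t i => y t₀ i - M * (t - t₀) with hm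
  have hmball : ∀ t ∈ Icc t₀ t₁, ‖m t - y t₀‖ ≤ ρ := fun t ht' => by
    have h0 : 0 ≤ M * (t - t₀) := mul_nonneg hM (sub_nonneg.2 ht'.1)
    have h1 : M * (t - t₀) ≤ M * (t₁ - t₀) :=
      mul_le_mul_of_nonneg_left (by linarith [ht'.2]) hM
    refine (pi_norm_le_iff_of_nonneg (by linarith)).2 fun i => ?_
    simp only [hm, Pi.sub_apply, sub_sub_cancel_left, norm_neg, Real.norm_eq_abs, abs_of_nonneg h0]
    linarith
  have hmlow : IsStrictLower U f l (Icc t₀ t₁) (-M) m := by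
    refine ⟨Continuous.continuousOn (by fun_prop), fun t ht' => (hball _ (hmball t ht')).1,
      fun s _ t _ _ i => ?_, fun t ht' => (hball _ (hmball t ht')).2 _ (hl t)⟩
    simp only [hm]
    linarith
  have h₁ : StrongLT (m t₁) (x t₁) := hmlow.strongLT hU hUc hf (fun t _ => hmono _ (hl t))
    (fun t _ => hxU t) (fun t _ => hx t) (fun i => by simpa [hm] using h₀ i) t₁ ⟨ht, le_rfl⟩
  intro t htt
  exact (hz.mono fun s hs => hs.1).strongLT hU hUc hf (t₀ := t₁) (t₁ := t)
    (fun t _ => hmono _ (hl t)) (fun t _ => hxU t) (fun t _ => hx t)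
    (fun i => (hzy i).trans_lt (h₁ i)) t ⟨htt, le_rfl⟩

lemma exists_ball_bound (hU : IsOpen U)
    (hf : ContDiffOn ℝ 2 (fun z : (Fin n → ℝ) × ℝ => f z.1 z.2) (U ×ˢ univ)) {I : Set ℝ}
    (hI : IsCompact I) {c₀ : Fin n → ℝ} (hc₀ : c₀ ∈ U) :
    ∃ M ρ : ℝ, 0 ≤ M ∧ 0 < ρ ∧
      ∀ c, ‖c - c₀‖ ≤ ρ → c ∈ U ∧ ∀ a ∈ I, ∀ i, -M < f c a i := by
  obtain ⟨ρ, hρ, hsub⟩ := Metric.nhds_basis_closedBall.mem_iff.1 (hU.mem_nhds hc₀)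
  obtain ⟨M, hM⟩ := ((isCompact_closedBall c₀ ρ).prod hI).exists_bound_of_continuousOn
    (hf.continuousOn.mono (prod_mono hsub (subset_univ _)))
  refine ⟨|M| + 1, ρ, by positivity, hρ, fun c hc => ?_⟩
  have hc' : c ∈ Metric.closedBall c₀ ρ := by rwa [Metric.mem_closedBall, dist_eq_norm]
  refine ⟨hsub hc', fun a ha i => ?_⟩
  have h1 := (norm_le_pi_norm _ i).trans (hM (c, a) ⟨hc', ha⟩)
  have h2 := neg_le_of_abs_le h1
  have h3 := le_abs_self M
  simp only at h2
  linarith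

lemma exists_gap {a b : Fin n → ℝ} (h : StrongLT a b) : ∃ g : ℝ, 0 < g ∧ ∀ i, a i + g < b i := by
  have : ∀ᶠ g : ℝ in 𝓝[>] 0, ∀ i, a i + g < b i := by
    refine eventually_all.2 fun i => ?_
    have hc : Tendsto (fun g : ℝ => a i + g) (𝓝[>] 0) (𝓝 (a i + 0)) :=
      (Continuous.tendsto (by fun_prop) 0).mono_left nhdsWithin_le_nhds
    exact hc.eventually_lt_const (by simpa using h i)
  obtain ⟨g, hg, hg0⟩ := (this.and self_mem_nhdsWithin).exists
  exact ⟨g, hg0, hg⟩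

lemma eventually_mul_lt (A : ℝ) {a : ℝ} (ha : 0 < a) : ∀ᶠ ε : ℝ in 𝓝[>] 0, A * ε < a := by
  have hc : Tendsto (fun ε : ℝ => A * ε) (𝓝[>] 0) (𝓝 (A * 0)) :=
    (Continuous.tendsto (by fun_prop) 0).mono_left nhdsWithin_le_nhds
  exact hc.eventually_lt_const (by simpa using ha)

lemma isOpen_setOf_strongLT_zero : IsOpen {W : Fin n → ℝ | StrongLT W 0} := by
  simp only [StrongLT, ofPred_forall]
  exact isOpen_iInter_of_finite fun i => isOpen_lt (continuous_apply i) continuous_const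

lemma isOpen_setOf_zero_strongLT : IsOpen {W : Fin n → ℝ | StrongLT 0 W} := by
  simp only [StrongLT, ofPred_forall]
  exact isOpen_iInter_of_finite fun i => isOpen_lt continuous_const (continuous_apply i)

lemma convex_setOf_strongLT_zero : Convex ℝ {W : Fin n → ℝ | StrongLT W 0} :=
  fun _ ha _ hb _ _ hα hβ hαβ i => (convex_Iio (0 : ℝ)) (ha i) (hb i) hα hβ hαβ

lemma convex_setOf_zero_strongLT : Convex ℝ {W : Fin n → ℝ | StrongLT 0 W} :=
  fun _ ha _ hb _ _ hα hβ hαβ i => (convex_Ioi (0 : ℝ)) (ha i) (hb i) hα hβ hαβ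

lemma exists_neg_direction {A : Matrix (Fin n) (Fin n) ℝ}
    (h : ∃ w, StrongLT 0 w ∧ StrongLT (A.mulVec w) 0) :
    ∃ W ∈ {W : Fin n → ℝ | StrongLT W 0}, StrongLT 0 (A.mulVec W) := by
  obtain ⟨w, hw, hAw⟩ := h
  refine ⟨-w, fun i => by simpa using hw i, fun i => ?_⟩
  rw [Matrix.mulVec_neg]
  simpa using hAw i

/-- The path is frozen after `u` by `min s u`, so its right limit is `X u` and no condition at `+∞`
is required. -/
lemma exists_lower_curve_below {L : ℝ → ℝ} {X : ℝ → (Fin n → ℝ)} {Xm Xp : Fin n → ℝ}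
    {lm : ℝ} (hU : IsOpen U)
    (hf : ContDiffOn ℝ 2 (fun z : (Fin n → ℝ) × ℝ => f z.1 z.2) (U ×ˢ univ))
    (h : IsPath U f L X Xm Xp) (hL : Continuous L) (hLm : Tendsto L atBot (𝓝 lm))
    (hdir : ∀ s, ∃ w, StrongLT 0 w ∧
      StrongLT ((jacobian (fun x => f x (L s)) (X s)).mulVec w) 0)
    (hdirm : ∃ w, StrongLT 0 w ∧ StrongLT ((jacobian (fun x => f x lm) Xm).mulVec w) 0)
    (u : ℝ) {e : ℝ} (he : 0 < e) :
    ∃ (y : ℝ → (Fin n → ℝ)) (ym : Fin n → ℝ) (K : NNReal) (ρ : ℝ), 0 < ρ ∧ LipschitzWith K y ∧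
      (∀ s ≤ u, y s ∈ U ∧ ‖y s - X s‖ < e ∧ ∀ i, ρ < f (y s) (L s) i) ∧
      Tendsto y atBot (𝓝 ym) ∧ StrongLT ym Xm := by
  have hmin : Continuous fun s : ℝ => min s u := by fun_prop
  have hbot : Tendsto (fun s : ℝ => min s u) atBot atBot :=
    tendsto_atBot_mono (fun s => min_le_left s u) tendsto_id
  have htop : ∀ᶠ s : ℝ in atTop, u = min s u :=
    (eventually_ge_atTop u).mono fun s hs => (min_eq_right hs).symm
  have hpath : IsPath U f (fun s => L (min s u)) (fun s => X (min s u)) Xm (X u) :=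
    ⟨h.continuous.comp hmin, fun s => h.mem _, fun s => h.equilibrium _, h.limit_mem_left, h.mem u,
      h.tendsto_atBot.comp hbot, tendsto_const_nhds.congr' (htop.mono fun s hs => congrArg X hs)⟩
  obtain ⟨y, ym, yp, K, ρ, hρ, hK, hy, hm, -, hmC, -⟩ := hpath.exists_lower_curve hU hf
    (hL.comp hmin) (hLm.comp hbot)
    (tendsto_const_nhds.congr' (f₁ := fun _ => L u) (htop.mono fun s hs => congrArg L hs))
    isOpen_setOf_strongLT_zero convex_setOf_strongLT_zero
    (fun η hη v hv i => by simpa using mul_neg_of_pos_of_neg hη (hv i))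
    (fun s => exists_neg_direction (hdir _)) (exists_neg_direction hdirm)
    (exists_neg_direction (hdir u)) he
  refine ⟨y, ym, K, ρ, hρ, hK, fun s hs => ?_, hm, fun i => by simpa using hmC i⟩
  have := hy s
  rwa [min_eq_left hs] at this

/-- Here the path is frozen before `v`, and the curve is displaced upwards. -/
lemma exists_lower_curve_above {L : ℝ → ℝ} {X : ℝ → (Fin n → ℝ)} {Xm Xp : Fin n → ℝ}
    {lp : ℝ} (hU : IsOpen U)
    (hf : ContDiffOn ℝ 2 (fun z : (Fin n → ℝ) × ℝ => f z.1 z.2) (U ×ˢ univ))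
    (h : IsPath U f L X Xm Xp) (hL : Continuous L) (hLp : Tendsto L atTop (𝓝 lp))
    (hdir : ∀ s, ∃ w, StrongLT 0 w ∧
      StrongLT 0 ((jacobian (fun x => f x (L s)) (X s)).mulVec w))
    (hdirp : ∃ w, StrongLT 0 w ∧ StrongLT 0 ((jacobian (fun x => f x lp) Xp).mulVec w))
    (v : ℝ) {e : ℝ} (he : 0 < e) :
    ∃ (y : ℝ → (Fin n → ℝ)) (yp : Fin n → ℝ) (K : NNReal) (ρ : ℝ), 0 < ρ ∧ LipschitzWith K y ∧
      (∀ s ≥ v, y s ∈ U ∧ ‖y s - X s‖ < e ∧ ∀ i, ρ < f (y s) (L s) i) ∧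
      Tendsto y atTop (𝓝 yp) ∧ StrongLT Xp yp := by
  have hmax : Continuous fun s : ℝ => max s v := by fun_prop
  have htop : Tendsto (fun s : ℝ => max s v) atTop atTop :=
    tendsto_atTop_mono (fun s => le_max_left s v) tendsto_id
  have hbot : ∀ᶠ s : ℝ in atBot, v = max s v :=
    (eventually_le_atBot v).mono fun s hs => (max_eq_right hs).symm
  have hpath : IsPath U f (fun s => L (max s v)) (fun s => X (max s v)) (X v) Xp :=
    ⟨h.continuous.comp hmax, fun s => h.mem _, fun s => h.equilibrium _, h.mem v,
      h.limit_mem_right, tendsto_const_nhds.congr' (hbot.mono fun s hs => congrArg X hs),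
      h.tendsto_atTop.comp htop⟩
  obtain ⟨y, ym, yp, K, ρ, hρ, hK, hy, -, hp, -, hpC⟩ := hpath.exists_lower_curve hU hf
    (hL.comp hmax)
    (tendsto_const_nhds.congr' (f₁ := fun _ => L v) (hbot.mono fun s hs => congrArg L hs))
    (hLp.comp htop) isOpen_setOf_zero_strongLT convex_setOf_zero_strongLT
    (fun η hη v hv i => by simpa using mul_pos hη (hv i))
    (fun s => hdir _) (hdir v) hdirp he
  refine ⟨y, yp, K, ρ, hρ, hK, fun s hs => ?_, hp, fun i => by simpa using hpC i⟩
  have := hy s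
  rwa [max_eq_left hs] at this

lemma apply_sub_le_of_lipschitzWith {K : NNReal} {y : ℝ → (Fin n → ℝ)} (hy : LipschitzWith K y)
    {s t : ℝ} (hst : s ≤ t) (i : Fin n) : y t i - y s i ≤ K * (t - s) := by
  have h := hy.dist_le_mul t s
  rw [dist_eq_norm, Real.dist_eq, abs_of_nonneg (sub_nonneg.2 hst)] at h
  exact (le_abs_self _).trans ((norm_le_pi_norm (y t - y s) i).trans h)

/-- The change of time `u + ε t + (v - u) S(t / δ)`, where `S` is a smooth transition from `0` to
`1`: it moves at the slow rate `ε` except for a jump by `v - u` during `[0, δ]`. -/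
noncomputable def jumpTime (u v ε δ t : ℝ) : ℝ :=
  u + ε * t + (v - u) * Real.smoothTransition (t / δ)

lemma jumpTime_of_nonpos {u v ε δ t : ℝ} (hδ : 0 < δ) (ht : t ≤ 0) :
    jumpTime u v ε δ t = u + ε * t := by
  rw [jumpTime, Real.smoothTransition.zero_of_nonpos (div_nonpos_of_nonpos_of_nonneg ht hδ.le)]
  ring

lemma jumpTime_of_le {u v ε δ t : ℝ} (hδ : 0 < δ) (ht : δ ≤ t) :
    jumpTime u v ε δ t = v + ε * t := by
  rw [jumpTime, Real.smoothTransition.one_of_one_le ((one_le_div hδ).2 ht)]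
  ring

lemma contDiff_jumpTime (u v ε δ : ℝ) : ContDiff ℝ 2 (jumpTime u v ε δ) := by
  have h : ContDiff ℝ 2 Real.smoothTransition := Real.smoothTransition.contDiff (n := 2)
  have h2 : ContDiff ℝ 2 fun t : ℝ => t / δ := by fun_prop
  exact (contDiff_const.add (contDiff_const.mul contDiff_id)).add
    (contDiff_const.mul (h.comp h2))

lemma isReparametrization_jumpTime {u v ε δ : ℝ} (huv : u < v) (hε : 0 < ε) (hδ : 0 < δ) :
    IsReparametrization (jumpTime u v ε δ) := by
  refine ⟨contDiff_jumpTime u v ε δ, fun s => ?_, ?_, ?_⟩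
  · have h : Differentiable ℝ fun t => (v - u) * Real.smoothTransition (t / δ) := by
      have h : ContDiff ℝ 2 Real.smoothTransition := Real.smoothTransition.contDiff (n := 2)
      have h2 : Differentiable ℝ Real.smoothTransition := h.differentiable (by norm_num)
      exact (h2.comp (differentiable_id.div_const δ)).const_mul _
    have hmono : Monotone fun t => (v - u) * Real.smoothTransition (t / δ) := fun a b hab =>
      mul_le_mul_of_nonneg_left (Real.smoothTransition.monotone
        (div_le_div_of_nonneg_right hab hδ.le)) (sub_nonneg.2 huv.le)
    have h1 : HasDerivAt (fun t => u + ε * t) ε s := by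
      simpa using ((hasDerivAt_id s).const_mul ε).const_add u
    have h2 : deriv (jumpTime u v ε δ) s
        = ε + deriv (fun t => (v - u) * Real.smoothTransition (t / δ)) s :=
      (h1.add (h s).hasDerivAt).deriv
    rw [h2]
    linarith [hmono.deriv_nonneg (x := s)]
  · refine Tendsto.congr' (f₁ := fun t => u + ε * t) ?_ ?_
    · filter_upwards [eventually_le_atBot 0] with t ht using (jumpTime_of_nonpos hδ ht).symm
    · exact tendsto_atBot_add_const_left _ _ (tendsto_id.const_mul_atBot hε)
  · refine Tendsto.congr' (f₁ := fun t => v + ε * t) ?_ ?_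
    · filter_upwards [eventually_ge_atTop δ] with t ht using (jumpTime_of_le hδ ht).symm
    · exact tendsto_atTop_add_const_left _ _ (tendsto_id.const_mul_atTop hε)

lemma deriv_jumpTime_of_neg {u v ε δ t : ℝ} (hδ : 0 < δ) (ht : t < 0) :
    deriv (jumpTime u v ε δ) t = ε := by
  have h : jumpTime u v ε δ =ᶠ[𝓝 t] fun t => u + ε * t := by
    filter_upwards [Iio_mem_nhds ht] with s hs using jumpTime_of_nonpos hδ (le_of_lt hs)
  rw [h.deriv_eq]
  simp

lemma deriv_jumpTime_of_lt {u v ε δ t : ℝ} (hδ : 0 < δ) (ht : δ < t) :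
    deriv (jumpTime u v ε δ) t = ε := by
  have h : jumpTime u v ε δ =ᶠ[𝓝 t] fun t => v + ε * t := by
    filter_upwards [Ioi_mem_nhds ht] with s hs using jumpTime_of_le hδ (le_of_lt hs)
  rw [h.deriv_eq]
  simp

/-- Outside `[0, δ]` the change of time has constant slope `ε`, so the derivative of the composition
still tends to `0` at both ends. -/
lemma IsParameterShift.comp_jumpTime {lm lp : ℝ} {L : ℝ → ℝ} (hL : IsParameterShift lm lp L)
    {u v ε δ : ℝ} (huv : u < v) (hε : 0 < ε) (hδ : 0 < δ) :
    IsParameterShift lm lp (L ∘ jumpTime u v ε δ) := by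
  have hσ := isReparametrization_jumpTime huv hε hδ
  have hd : ∀ t, deriv (L ∘ jumpTime u v ε δ) t
      = deriv L (jumpTime u v ε δ t) * deriv (jumpTime u v ε δ) t := fun t =>
    deriv_comp t ((hL.contDiff.differentiable (by norm_num)) _)
      ((hσ.contDiff.differentiable (by norm_num)) _)
  refine ⟨hL.contDiff.comp hσ.contDiff, fun s => hL.mem_Ioo _,
    hL.tendsto_atBot.comp hσ.tendsto_atBot, hL.tendsto_atTop.comp hσ.tendsto_atTop, ?_, ?_⟩
  · have h := (hL.deriv_atBot.comp hσ.tendsto_atBot).mul_const ε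
    rw [zero_mul] at h
    refine h.congr' ?_
    filter_upwards [eventually_lt_atBot 0] with t ht
    rw [hd, deriv_jumpTime_of_neg hδ ht, Function.comp_apply]
  · have h := (hL.deriv_atTop.comp hσ.tendsto_atTop).mul_const ε
    rw [zero_mul] at h
    refine h.congr' ?_
    filter_upwards [eventually_gt_atTop δ] with t ht
    rw [hd, deriv_jumpTime_of_lt hδ ht, Function.comp_apply]

lemma eventually_strongLT {l : Filter ℝ} {x y : ℝ → (Fin n → ℝ)} {a b : Fin n → ℝ}
    (hx : Tendsto x l (𝓝 a)) (hy : Tendsto y l (𝓝 b)) (hab : StrongLT a b) :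
    ∀ᶠ t in l, StrongLT (x t) (y t) :=
  eventually_all.2 fun i => (tendsto_pi_nhds.1 hx i).eventually_lt (tendsto_pi_nhds.1 hy i) (hab i)

section

variable (hU : IsOpen U) (hUc : PConvex U)
  (hf : ContDiffOn ℝ 2 (fun z : (Fin n → ℝ) × ℝ => f z.1 z.2) (U ×ˢ univ))
  {lm lp : ℝ} {L : ℝ → ℝ} (hL : IsParameterShift lm lp L)
  (hmono : ∀ l ∈ Icc lm lp, IsMonotoneSystem U (fun x => f x l))
  {p : ℝ → (Fin n → ℝ)} {pm pp : Fin n → ℝ} (hp : IsPath U f L p pm pp)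
  {q : ℝ → (Fin n → ℝ)} {qm qp : Fin n → ℝ} (hq : IsPath U f L q qm qp)
  (hqdir : ∀ s, ∃ w, StrongLT 0 w ∧ StrongLT ((jacobian (fun x => f x (L s)) (q s)).mulVec w) 0)
  (hqdirm : ∃ w, StrongLT 0 w ∧ StrongLT ((jacobian (fun x => f x lm) qm).mulVec w) 0)
  (hpdir : ∀ s, ∃ w, StrongLT 0 w ∧ StrongLT 0 ((jacobian (fun x => f x (L s)) (p s)).mulVec w))
  (hpdirp : ∃ w, StrongLT 0 w ∧ StrongLT 0 ((jacobian (fun x => f x lp) pp).mulVec w))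
  (hn : Nonempty (Fin n)) (hqp : StrongLT qp pp)

include hU hUc hf hL hmono hp hq hqdir hqdirm hpdir hpdirp hn hqp in
theorem exists_reparametrization_not_endpointTracks {u v : ℝ} (huv : u < v)
    (hpq : StrongLT (p v) (q u)) :
    ∃ σ : ℝ → ℝ, IsReparametrization σ ∧ IsParameterShift lm lp (L ∘ σ) ∧
      ∃ r : ℝ, 0 < r ∧ ¬ EndpointTracks U f (L ∘ σ) r qm qp := by
  obtain ⟨g, hg, hgap⟩ := exists_gap hpq
  -- The gap `g` pays for four errors: the distances of `y u` from `q u` and of `z v` from `p v`,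
  -- the loss `M δ` during the jump, and the growth of `z` by at most `K' ε δ` while the jump lasts.
  have hg4 : 0 < g / 4 := by positivity
  have hLc := hL.contDiff.continuous
  obtain ⟨y, ym, K, ρ, hρ, hK, hy, hym, hymq⟩ := exists_lower_curve_below hU hf hq hLc
    hL.tendsto_atBot hqdir hqdirm u hg4
  obtain ⟨z, zp, K', ρ', hρ', hK', hz, hzp, hzpp⟩ := exists_lower_curve_above hU hf hp hLc
    hL.tendsto_atTop hpdir hpdirp v hg4
  obtain ⟨M, d, hM, hd, hball⟩ := exists_ball_bound hU hf (isCompact_Icc (a := lm) (b := lp))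
    (hy u le_rfl).1
  obtain ⟨δ, ⟨hδ1, hδ2⟩, hδ⟩ := (((eventually_mul_lt M hd).and (eventually_mul_lt M hg4)).and
    (self_mem_nhdsWithin (a := (0 : ℝ)) (s := Ioi 0))).exists
  have hδ : 0 < δ := hδ
  -- Traversed at speed `ε`, the curves grow at rates at most `K ε` and `K' ε`, here forced below
  -- the lower bounds `ρ` and `ρ'` of the field.
  obtain ⟨ε, ⟨hε1, hε2, hε3⟩, hε⟩ := (((eventually_mul_lt K hρ).and ((eventually_mul_lt K' hρ').and
    (eventually_mul_lt (K' * δ) hg4))).and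
    (self_mem_nhdsWithin (a := (0 : ℝ)) (s := Ioi 0))).exists
  have hε : 0 < ε := hε
  refine ⟨jumpTime u v ε δ, isReparametrization_jumpTime huv hε hδ,
    hL.comp_jumpTime huv hε hδ, 1, one_pos, ?_⟩
  rintro ⟨x, hx, hxlim⟩
  set l : ℝ → ℝ := fun t => L (jumpTime u v ε δ t) with hl
  have hxd : ∀ t, HasDerivAt x (f (x t) (l t)) t := fun t => by
    simpa [hl] using hx.hasDerivAt t (mem_univ t)
  have hylow : IsStrictLower U f l (Iic 0) (K * ε) (fun t => y (u + ε * t)) := by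
    have hle : ∀ t ∈ Iic (0 : ℝ), u + ε * t ≤ u := fun t ht => by
      have := mul_nonpos_of_nonneg_of_nonpos hε.le (mem_Iic.1 ht)
      linarith
    refine ⟨(hK.continuous.comp (by fun_prop)).continuousOn, fun t ht => (hy _ (hle t ht)).1,
      fun s _ t _ hst i => ?_, fun t ht i => ?_⟩
    · refine (apply_sub_le_of_lipschitzWith hK (by gcongr) i).trans (le_of_eq ?_)
      ring
    · simp only [hl]
      rw [jumpTime_of_nonpos hδ ht]
      exact hε1.trans ((hy _ (hle t ht)).2.2 i)
  have hzlow : IsStrictLower U f l (Ici δ) (K' * ε) (fun t => z (v + ε * t)) := by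
    have hle : ∀ t ∈ Ici δ, v ≤ v + ε * t := fun t ht => by
      have := mul_nonneg hε.le (hδ.le.trans ht)
      linarith
    refine ⟨(hK'.continuous.comp (by fun_prop)).continuousOn, fun t ht => (hz _ (hle t ht)).1,
      fun s _ t _ hst i => ?_, fun t ht i => ?_⟩
    · refine (apply_sub_le_of_lipschitzWith hK' (by gcongr) i).trans (le_of_eq ?_)
      ring
    · simp only [hl]
      rw [jumpTime_of_le hδ ht]
      exact hε2.trans ((hz _ (hle t ht)).2.2 i)
  have hbot : Tendsto (fun t => u + ε * t) atBot atBot :=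
    tendsto_atBot_add_const_left _ _ (tendsto_id.const_mul_atBot hε)
  have htop : Tendsto (fun t => v + ε * t) atTop atTop :=
    tendsto_atTop_add_const_left _ _ (tendsto_id.const_mul_atTop hε)
  have habove := strongLT_of_three_phases hU hUc hf hmono
    (fun t => Ioo_subset_Icc_self (hL.mem_Ioo _)) (fun t => hx.mem t (mem_univ t)) hxd hδ.le hylow
    (eventually_strongLT (hym.comp hbot) hx.tendsto_atBot hymq) hM (ρ := d)
    (by simpa using hball) (by simpa using hδ1.le) hzlow (fun i => by
      have h1 := apply_sub_le_of_lipschitzWith hK' (s := v) (t := v + ε * δ)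
        (by linarith [mul_pos hε hδ]) i
      have h2 := (abs_lt.1 ((norm_le_pi_norm (z v - p v) i).trans_lt (hz v le_rfl).2.1)).2
      have h3 := (abs_lt.1 ((norm_le_pi_norm (y u - q u) i).trans_lt (hy u le_rfl).2.1)).1
      have h4 := hgap i
      have h5 : (K' : ℝ) * (v + ε * δ - v) = K' * δ * ε := by ring
      simp only [Pi.sub_apply] at h2 h3
      simp only [mul_zero, add_zero, sub_zero]
      linarith)
  obtain ⟨i⟩ := hn
  -- The trajectory stays above `z`, so its limit dominates `zp`, although `zp ≫ pp ≫ qp`.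
  have hle : zp i ≤ qp i := le_of_tendsto_of_tendsto
    (tendsto_pi_nhds.1 (hzp.comp htop) i) (tendsto_pi_nhds.1 hxlim i)
    ((eventually_ge_atTop δ).mono fun t ht => (habove t ht i).le)
  linarith [hzpp i, hqp i]

lemma exists_pushed_equilibrium (hU : IsOpen U)
    (hf : ContDiffOn ℝ 2 (fun z : (Fin n → ℝ) × ℝ => f z.1 z.2) (U ×ˢ univ))
    {X : Fin n → ℝ} {a : ℝ} (hX : X ∈ U) (hX0 : f X a = 0) {C : Set (Fin n → ℝ)} (hCo : IsOpen C)
    (hCc : Convex ℝ C) (hC : ∀ η : ℝ, 0 < η → ∀ v ∈ C, η • v ∈ C)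
    (hdir : ∃ W ∈ C, StrongLT 0 ((jacobian (fun x => f x a) X).mulVec W))
    {e : ℝ} (he : 0 < e) :
    ∃ c ∈ U, ‖c - X‖ < e ∧ c - X ∈ C ∧ ∀ᶠ l in 𝓝 a, ∀ i, 0 < f c l i := by
  -- A single equilibrium is a family over a one-point space.
  obtain ⟨y, ρ, -, hρ, hy⟩ := exists_pushed_family (S := Unit) hU hf (X := fun _ => X)
    (l := fun _ => a) continuous_const continuous_const (fun _ => hX) (fun _ => hX0) hCo hCc hC
    (fun _ => hdir) he
  obtain ⟨h1, h2, h3, h4⟩ := hy () (y ()) (by simpa using hρ)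
  refine ⟨y (), h1, h2, h4, eventually_all.2 fun i => ?_⟩
  have hc : ContinuousAt (fun l => f (y ()) l i) a :=
    (continuous_apply i).continuousAt.comp ((continuousAt_uncurry hU hf h1 a).comp
      (f := fun l => (y (), l)) (x := a) (by fun_prop))
  exact hc.eventually_const_lt (hρ.trans (h3 i))

lemma isStrictLower_const {l : ℝ → ℝ} {J : Set ℝ} {c : Fin n → ℝ} (hc : c ∈ U)
    (h : ∀ t ∈ J, ∀ i, 0 < f c (l t) i) : IsStrictLower U f l J 0 (fun _ => c) :=
  ⟨continuousOn_const, fun _ _ => hc, fun _ _ _ _ _ _ => by simp, h⟩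

include hU hUc hf hL hmono hp hq hqdirm hpdirp hn hqp in
theorem exists_rate_not_endpointTracks (hpq : StrongLT pp qm) :
    ∃ r₀ : ℝ, 0 < r₀ ∧ ∀ r : ℝ, r₀ < r → ¬ EndpointTracks U f L r qm qp := by
  obtain ⟨g, hg, hgap⟩ := exists_gap hpq
  have hg4 : 0 < g / 4 := by positivity
  obtain ⟨c, hcU, hce, hcC, hc⟩ := exists_pushed_equilibrium hU hf hq.limit_mem_left
    (hq.equilibrium_left hU hf hL.tendsto_atBot) isOpen_setOf_strongLT_zero
    convex_setOf_strongLT_zero (fun η hη v hv i => by simpa using mul_neg_of_pos_of_neg hη (hv i))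
    (exists_neg_direction hqdirm) hg4
  obtain ⟨c', hcU', hce', hcC', hc'⟩ := exists_pushed_equilibrium hU hf hp.limit_mem_right
    (hp.equilibrium_right hU hf hL.tendsto_atTop) isOpen_setOf_zero_strongLT
    convex_setOf_zero_strongLT (fun η hη v hv i => by simpa using mul_pos hη (hv i)) hpdirp hg4
  -- The constants `c` and `c'` are lower solutions while `s ≤ a` and `s ≥ b`. The parameter crosses
  -- `[a, b]` in time `(b - a) / r`, so the loss in between vanishes as `r → ∞`.
  obtain ⟨a, ha⟩ := eventually_atBot.1 (hL.tendsto_atBot.eventually hc)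
  obtain ⟨b', hb'⟩ := eventually_atTop.1 (hL.tendsto_atTop.eventually hc')
  set b := max a b' with hb
  have hab : a ≤ b := le_max_left _ _
  have hbb : ∀ s, b ≤ s → ∀ i, 0 < f c' (L s) i := fun s hs => hb' s ((le_max_right _ _).trans hs)
  obtain ⟨M, d, hM, hd, hball⟩ := exists_ball_bound hU hf (isCompact_Icc (a := lm) (b := lp)) hcU
  obtain ⟨δ, ⟨hδ1, hδ2⟩, hδ⟩ := (((eventually_mul_lt (M * (b - a)) hd).and
    (eventually_mul_lt (M * (b - a)) hg4)).and
    (self_mem_nhdsWithin (a := (0 : ℝ)) (s := Ioi 0))).exists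
  have hδ : 0 < δ := hδ
  refine ⟨δ⁻¹, inv_pos.2 hδ, fun r hr => ?_⟩
  have hr0 : 0 < r := (inv_pos.2 hδ).trans hr
  rintro ⟨x, hx, hxlim⟩
  have hMr : M * (b / r - a / r) ≤ M * (b - a) * δ := by
    have h1 : r⁻¹ ≤ δ := inv_le_of_inv_le₀ hδ hr.le
    calc M * (b / r - a / r) = M * (b - a) * r⁻¹ := by ring
      _ ≤ M * (b - a) * δ := mul_le_mul_of_nonneg_left h1 (mul_nonneg hM (sub_nonneg.2 hab))
  have hlow : IsStrictLower U f (fun t => L (r * t)) (Iic (a / r)) 0 (fun _ => c) :=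
    isStrictLower_const hcU fun t ht => ha _ (by
      have := (le_div_iff₀ hr0).1 (mem_Iic.1 ht); linarith)
  have hlow' : IsStrictLower U f (fun t => L (r * t)) (Ici (b / r)) 0 (fun _ => c') :=
    isStrictLower_const hcU' fun t ht => hbb _ (by
      have := (div_le_iff₀ hr0).1 (mem_Ici.1 ht); linarith)
  have habove := strongLT_of_three_phases hU hUc hf hmono
    (fun t => Ioo_subset_Icc_self (hL.mem_Ioo (r * t))) (fun t => hx.mem t (mem_univ t))
    (fun t => hx.hasDerivAt t (mem_univ t)) (div_le_div_of_nonneg_right hab hr0.le) hlow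
    (eventually_strongLT tendsto_const_nhds hx.tendsto_atBot fun i => by simpa using hcC i) hM
    hball (hMr.trans hδ1.le) hlow' (fun i => by
      have h2 := (abs_lt.1 ((norm_le_pi_norm (c' - pp) i).trans_lt hce')).2
      have h3 := (abs_lt.1 ((norm_le_pi_norm (c - qm) i).trans_lt hce)).1
      have h4 := hgap i
      simp only [Pi.sub_apply] at h2 h3
      linarith)
  obtain ⟨i⟩ := hn
  have hle : c' i ≤ qp i := le_of_tendsto_of_tendsto tendsto_const_nhds
    (tendsto_pi_nhds.1 hxlim i)
    ((eventually_ge_atTop (b / r)).mono fun t ht => (habove t ht i).le)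
  have h1 : 0 < c' i - pp i := hcC' i
  linarith [hqp i]

end

end Tipping

/-! ### Reversing the order by `x ↦ -x`. -/

section Reflection

variable {n : ℕ} {U : Set (Fin n → ℝ)} {f : (Fin n → ℝ) → ℝ → (Fin n → ℝ)}

/-- The vector field obtained from `f` by the reflection `x ↦ -x`. -/
def reflect (f : (Fin n → ℝ) → ℝ → (Fin n → ℝ)) (x : Fin n → ℝ) (l : ℝ) : Fin n → ℝ :=
  -f (-x) l

/-- The two signs cancel, so cooperativity and the conditions on positive directions carry over
unchanged. -/
lemma jacobian_reflect (l : ℝ) (x : Fin n → ℝ) :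
    jacobian (fun x => reflect f x l) x = jacobian (fun x => f x l) (-x) := by
  ext i j
  have h : fderiv ℝ (fun x => reflect f x l) x = fderiv ℝ (fun x => f x l) (-x) := by
    have h1 := (ContinuousLinearEquiv.neg ℝ (M := Fin n → ℝ)).comp_right_fderiv
      (f := fun x => f x l) (x := x)
    have h2 : fderiv ℝ (fun x => f (-x) l) x = fderiv ℝ ((fun x => f x l) ∘
      ContinuousLinearEquiv.neg ℝ (M := Fin n → ℝ)) x := rfl
    simp only [reflect]
    rw [fderiv_fun_neg, h2, h1]
    ext v i
    simp
  simp [jacobian, h]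

lemma pconvex_reflect (h : PConvex U) : PConvex (Neg.neg ⁻¹' U) := by
  rintro x hx y hy hxy _ ⟨a, b, ha, hb, hab, rfl⟩
  refine h (-y) hy (-x) hx (neg_le_neg hxy) ⟨b, a, hb, ha, by linarith, ?_⟩
  module

lemma contDiffOn_reflect
    (hf : ContDiffOn ℝ 2 (fun z : (Fin n → ℝ) × ℝ => f z.1 z.2) (U ×ˢ univ)) :
    ContDiffOn ℝ 2 (fun z : (Fin n → ℝ) × ℝ => reflect f z.1 z.2) ((Neg.neg ⁻¹' U) ×ˢ univ) := by
  have h : ContDiff ℝ 2 fun z : (Fin n → ℝ) × ℝ => (-z.1, z.2) := by fun_prop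
  exact (hf.comp h.contDiffOn fun z hz => ⟨hz.1, mem_univ _⟩).neg

lemma isMonotoneSystem_reflect {l : ℝ} (h : IsMonotoneSystem U (fun x => f x l)) :
    IsMonotoneSystem (Neg.neg ⁻¹' U) (fun x => reflect f x l) := fun x hx i j hij => by
  rw [jacobian_reflect]
  exact h (-x) hx i j hij

lemma IsPath.reflect {L : ℝ → ℝ} {X : ℝ → (Fin n → ℝ)} {Xm Xp : Fin n → ℝ}
    (h : IsPath U f L X Xm Xp) :
    IsPath (Neg.neg ⁻¹' U) (reflect f) L (fun s => -X s) (-Xm) (-Xp) :=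
  ⟨h.continuous.neg, fun s => by simpa using h.mem s,
    fun s => by simp [RTip.reflect, h.equilibrium s],
    by simpa using h.limit_mem_left, by simpa using h.limit_mem_right, h.tendsto_atBot.neg,
    h.tendsto_atTop.neg⟩

lemma EndpointTracks.reflect {L : ℝ → ℝ} {r : ℝ} {Xm Xp : Fin n → ℝ}
    (h : EndpointTracks U f L r Xm Xp) :
    EndpointTracks (Neg.neg ⁻¹' U) (reflect f) L r (-Xm) (-Xp) := by
  obtain ⟨x, hx, hlim⟩ := h
  refine ⟨fun t => -x t, ⟨fun t ht => by simpa using hx.mem t ht, fun t ht => ?_,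
    hx.tendsto_atBot.neg⟩, hlim.neg⟩
  simpa [RTip.reflect] using (hx.hasDerivAt t ht).fun_neg

lemma strongLT_neg {a b : Fin n → ℝ} (h : StrongLT a b) : StrongLT (-b) (-a) :=
  fun i => neg_lt_neg (h i)

end Reflection

/-! ### Positive directions from the spectral hypotheses. -/

section Directions

variable {n : ℕ}

/-- An eigenvector is nonzero, which rules out dimension `0`. There `StrongLT` is vacuous and the
final contradiction would have no component to be read from. -/
lemma HasPositiveUnstableDirection.nonempty {g : (Fin n → ℝ) → (Fin n → ℝ)} {x : Fin n → ℝ}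
    (h : HasPositiveUnstableDirection g x) : Nonempty (Fin n) := by
  obtain ⟨μ, -, v, -, hv⟩ := h
  by_contra hn
  rw [not_nonempty_iff] at hn
  exact hv.2 (Subsingleton.elim _ _)

lemma HasPositiveUnstableDirection.exists_direction {g : (Fin n → ℝ) → (Fin n → ℝ)}
    {x : Fin n → ℝ} (h : HasPositiveUnstableDirection g x) :
    ∃ w, StrongLT 0 w ∧ StrongLT 0 ((jacobian g x).mulVec w) := by
  obtain ⟨μ, hμ, v, hv, hev⟩ := h
  refine ⟨v, hv, fun i => ?_⟩
  have := hev.apply_eq_smul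
  rw [Matrix.toLin'_apply] at this
  rw [this]
  exact mul_pos hμ (hv i)

lemma IsAttractingEquilibrium.exists_direction {U : Set (Fin n → ℝ)}
    {g : (Fin n → ℝ) → (Fin n → ℝ)} {x : Fin n → ℝ} (hmono : IsMonotoneSystem U g) (hx : x ∈ U)
    (h : IsAttractingEquilibrium g x) :
    ∃ w, StrongLT 0 w ∧ StrongLT ((jacobian g x).mulVec w) 0 :=
  exists_pos_mulVec_neg (hmono x hx) h.2

end Directions

end RTip

/-! ### The proposition, in both orders. -/

theorem proposition5p4 {n : ℕ} (U : Set (Fin n → ℝ)) (hU : IsOpen U) (hUc : RTip.PConvex U)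
    (f : (Fin n → ℝ) → ℝ → (Fin n → ℝ))
    (hf : ContDiffOn ℝ 2 (fun z : (Fin n → ℝ) × ℝ => f z.1 z.2) (U ×ˢ Set.univ))
    (lm lp : ℝ) (L : ℝ → ℝ) (hL : RTip.IsParameterShift lm lp L)
    (hmono : ∀ l ∈ Set.Icc lm lp, RTip.IsMonotoneSystem U (fun x => f x l))
    (p : ℝ → (Fin n → ℝ)) (pm pp : Fin n → ℝ) (hp : RTip.IsPath U f L p pm pp)
    (q : ℝ → (Fin n → ℝ)) (qm qp : Fin n → ℝ) (hq : RTip.IsStablePath U f L q qm qp)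
    (hqm : RTip.IsAttractingEquilibrium (fun x => f x lm) qm)
    (hev : ∀ s, RTip.HasPositiveUnstableDirection (fun x => f x (L s)) (p s))
    (hevm : RTip.HasPositiveUnstableDirection (fun x => f x lm) pm)
    (hevp : RTip.HasPositiveUnstableDirection (fun x => f x lp) pp) :
    (((∀ s, StrongLT (q s) (p s)) ∧ StrongLT qm pm ∧ StrongLT qp pp) →
      ((∃ u v : ℝ, u < v ∧ StrongLT (p v) (q u)) →
        ∃ σ : ℝ → ℝ, RTip.IsReparametrization σ ∧ RTip.IsParameterShift lm lp (L ∘ σ) ∧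
          ∃ r : ℝ, 0 < r ∧ RTip.RTipping U f (L ∘ σ) r qm qp) ∧
      (StrongLT pp qm →
        ∃ r₀ : ℝ, 0 < r₀ ∧ ∀ r : ℝ, r₀ < r → RTip.RTipping U f L r qm qp)) ∧
    (((∀ s, StrongLT (p s) (q s)) ∧ StrongLT pm qm ∧ StrongLT pp qp) →
      ((∃ u v : ℝ, u < v ∧ StrongLT (q u) (p v)) →
        ∃ σ : ℝ → ℝ, RTip.IsReparametrization σ ∧ RTip.IsParameterShift lm lp (L ∘ σ) ∧
          ∃ r : ℝ, 0 < r ∧ RTip.RTipping U f (L ∘ σ) r qm qp) ∧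
      (StrongLT qm pp →
        ∃ r₀ : ℝ, 0 < r₀ ∧ ∀ r : ℝ, r₀ < r → RTip.RTipping U f L r qm qp)) := by
  have hqdir : ∀ s, ∃ w, StrongLT 0 w ∧
      StrongLT ((RTip.jacobian (fun x => f x (L s)) (q s)).mulVec w) 0 := fun s =>
    (hq.attracting s).exists_direction (hmono _ (Ioo_subset_Icc_self (hL.mem_Ioo s))) (hq.mem s)
  have hlm : lm ∈ Icc lm lp := ⟨le_rfl, ((hL.mem_Ioo 0).1.trans (hL.mem_Ioo 0).2).le⟩
  have hqdirm : ∃ w, StrongLT 0 w ∧ StrongLT ((RTip.jacobian (fun x => f x lm) qm).mulVec w) 0 :=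
    hqm.exists_direction (hmono _ hlm) hq.limit_mem_left
  have hpdir := fun s => (hev s).exists_direction
  have hpdirp := hevp.exists_direction
  have hn := hevp.nonempty
  obtain ⟨w, hw, hAw⟩ := hqdirm
  have hattr : ∀ L' r, RTip.IsParameterShift lm lp L' → 0 < r →
      RTip.HasPullbackAttractor U f L' r qm := fun L' r hL' hr =>
    RTip.hasPullbackAttractor hU hf hmono hq.limit_mem_left hqm.1 hw hAw hL'.contDiff.continuous
      (fun s => Ioo_subset_Icc_self (hL'.mem_Ioo s)) hL'.tendsto_atBot hr
  have hU' : IsOpen (Neg.neg ⁻¹' U) := hU.preimage continuous_neg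
  have hmono' : ∀ l ∈ Icc lm lp, RTip.IsMonotoneSystem (Neg.neg ⁻¹' U)
      (fun x => RTip.reflect f x l) := fun l hl => RTip.isMonotoneSystem_reflect (hmono l hl)
  have hqdir' : ∀ s, ∃ w, StrongLT 0 w ∧
      StrongLT ((RTip.jacobian (fun x => RTip.reflect f x (L s)) (-q s)).mulVec w) 0 := fun s => by
    rw [RTip.jacobian_reflect, neg_neg]; exact hqdir s
  have hqdirm' : ∃ w, StrongLT 0 w ∧
      StrongLT ((RTip.jacobian (fun x => RTip.reflect f x lm) (-qm)).mulVec w) 0 := by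
    rw [RTip.jacobian_reflect, neg_neg]; exact ⟨w, hw, hAw⟩
  have hpdir' : ∀ s, ∃ w, StrongLT 0 w ∧
      StrongLT 0 ((RTip.jacobian (fun x => RTip.reflect f x (L s)) (-p s)).mulVec w) := fun s => by
    rw [RTip.jacobian_reflect, neg_neg]; exact hpdir s
  have hpdirp' : ∃ w, StrongLT 0 w ∧
      StrongLT 0 ((RTip.jacobian (fun x => RTip.reflect f x lp) (-pp)).mulVec w) := by
    rw [RTip.jacobian_reflect, neg_neg]; exact hpdirp
  refine ⟨?_, ?_⟩
  · rintro ⟨-, -, hqp⟩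
    refine ⟨?_, fun hpq => ?_⟩
    · rintro ⟨u, v, huv, hpq⟩
      obtain ⟨σ, hσ, hLσ, r, hr, hnt⟩ := RTip.exists_reparametrization_not_endpointTracks hU hUc hf
        hL hmono hp hq.toIsPath hqdir ⟨w, hw, hAw⟩ hpdir hpdirp hn hqp huv hpq
      exact ⟨σ, hσ, hLσ, r, hr, hattr _ r hLσ hr, hnt⟩
    · obtain ⟨r₀, hr₀, hnt⟩ := RTip.exists_rate_not_endpointTracks hU hUc hf
        hL hmono hp hq.toIsPath ⟨w, hw, hAw⟩ hpdirp hn hqp hpq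
      exact ⟨r₀, hr₀, fun r hr => ⟨hattr _ r hL (hr₀.trans hr), hnt r hr⟩⟩
  -- Only the failure of tracking is obtained by reflection. Well-definedness of the pullback
  -- attractor does not depend on the order of `p` and `q`, so `hattr` applies directly.
  · rintro ⟨-, -, hqp⟩
    refine ⟨?_, fun hpq => ?_⟩
    · rintro ⟨u, v, huv, hpq⟩
      obtain ⟨σ, hσ, hLσ, r, hr, hnt⟩ := RTip.exists_reparametrization_not_endpointTracks hU'
        (RTip.pconvex_reflect hUc) (RTip.contDiffOn_reflect hf) hL hmono' hp.reflect
        hq.toIsPath.reflect hqdir' hqdirm' hpdir' hpdirp' hn (RTip.strongLT_neg hqp) huv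
        (RTip.strongLT_neg hpq)
      exact ⟨σ, hσ, hLσ, r, hr, hattr _ r hLσ hr, fun h => hnt h.reflect⟩
    · obtain ⟨r₀, hr₀, hnt⟩ := RTip.exists_rate_not_endpointTracks hU'
        (RTip.pconvex_reflect hUc) (RTip.contDiffOn_reflect hf) hL hmono' hp.reflect
        hq.toIsPath.reflect hqdirm' hpdirp' hn (RTip.strongLT_neg hqp) (RTip.strongLT_neg hpq)
      exact ⟨r₀, hr₀, fun r hr => ⟨hattr _ r hL (hr₀.trans hr), fun h => hnt r hr h.reflect⟩⟩
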